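/- Let $n\ge 1$ and let $M$ be a smooth manifold of dimension $4n$. Let $\mathbb H^n$ be the space of quaternionic row vectors and let $\mathrm{Sp}(1)\mathrm{GL}(n,\mathbb H)\subset \mathrm{GL}(4n,\mathbb R)$ be the group of maps $v\mapsto qvA$ with $q$ a unit quaternion and $A\in \mathrm{GL}(n,\mathbb H)$. Let $Q$ be an $\mathrm{Sp}(1)\mathrm{GL}(n,\mathbb H)$-structure on $M$, that is, a smooth principal subbundle with this structure group of the bundle of frames $T_xM\cong\mathbb H^n$. If $n\ge 2$, assume that $M$ is a quaternionic manifold, i.e. that $Q$ admits a torsion-free connection: there is a smooth torsion-free linear connection $\nabla$ on $TM$ whose connection form in every local section of $Q$ takes values in the Lie algebra $\mathfrak{sp}(1)+\mathfrak{gl}(n,\mathbb H)$. (If $n=1$, $Q$ is an oriented conformal structure and nothing more is assumed; in particular self-dual conformal $4$-manifolds are included.) A frame $p\in Q_x$ makes $\mathrm{Sp}(1)$ act on $T_xM$ by left multiplication, and hence on the complex-valued $k$-forms at $x$ by $(q\alpha)(v_1,\dots,v_k)=\alpha(q^{-1}v_1,\dots,q^{-1}v_k)$. For $r\in\mathbb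 Z$ let $(E_{k,r})_x\subseteq\Lambda^kT_x^*M\otimes\mathbb C$ be the sum of all irreducible complex $\mathrm{Sp}(1)$-subrepresentations of highest weight $r$ (weights taken with respect to $\mathrm U(1)=\{e^{i\theta}\}\subset \mathrm{Sp}(1)$); this does not depend on $p$, and it is $0$ for $r<0$. For real-valued forms, $(E_{k,r})_x$ consists of the real $k$-forms whose complexification lies in this subspace. Then, for all $k\ge0$ and all $r$, both for complex-valued and for real-valued forms, the subspaces $(E_{k+1,r+1})_x$ and $(E_{k+1,r-1})_x$ intersect trivially at every point $x$, and the exterior derivative $d$ maps $C^\infty(M,E_{k,r})$ into $C^\infty(M,E_{k+1,r+1}\oplus E_{k+1,r-1})$: if $\alpha$ is a smooth $k$-form with $\alpha_x\in (E_{k,r})_x$ for all $x\in M$, then $d\alpha$ is a smooth $(k+1)$-form with $(d\alpha)_x\in (E_{k+1,r+1})_x\oplus (E_{k+1,r-1})_x$ for all $x\in M$. -/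

import Mathlib

open scoped Manifold ContDiff Quaternion Bundle
open Set

namespace QuatDolbeault

noncomputable section

/-! ### The group `Sp(1) GL(n, ℍ)` and its Lie algebra, acting on `ℍⁿ` -/

/-- `Sp(1)`: the group of unit quaternions. -/
abbrev Sp1 : Type := unitary ℍ[ℝ]

/-- Left multiplication by a quaternion on the space `ℍⁿ` of row vectors. -/
def leftMul (n : ℕ) (q : ℍ[ℝ]) : (Fin n → ℍ[ℝ]) →L[ℝ] (Fin n → ℍ[ℝ]) :=
  LinearMap.toContinuousLinearMap
    { toFun := fun v i => q * v i
      map_add' := fun v w => by ext1 i; simp [mul_add]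
      map_smul' := fun c v => by ext1 i; simp }

/-- The subset `Sp(1) GL(n, ℍ)` of `GL(4n, ℝ)`: the maps `v ↦ q v A` with `q` a unit quaternion and
`A` an invertible quaternionic matrix acting on row vectors from the right. -/
def sp1GL (n : ℕ) : Set ((Fin n → ℍ[ℝ]) ≃L[ℝ] (Fin n → ℍ[ℝ])) :=
  {g | ∃ (q : Sp1) (A : GL (Fin n) ℍ[ℝ]),
    ∀ v, g v = leftMul n (q : ℍ[ℝ]) (Matrix.vecMul v (A : Matrix (Fin n) (Fin n) ℍ[ℝ]))}

/-- The Lie algebra `𝔰𝔭(1) + 𝔤𝔩(n, ℍ)` inside the endomorphisms of `ℍⁿ`: the maps `v ↦ a v + v B` with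
`a` an imaginary quaternion and `B` a quaternionic matrix. -/
def sp1glAlgebra (n : ℕ) : Set ((Fin n → ℍ[ℝ]) → (Fin n → ℍ[ℝ])) :=
  {f | ∃ (a : ℍ[ℝ]) (B : Matrix (Fin n) (Fin n) ℍ[ℝ]), a.re = 0 ∧
    ∀ v, f v = leftMul n a v + Matrix.vecMul v B}

/-! ### Representations of `Sp(1)` and highest weights -/

/-- The quaternion `exp(iθ) = cos θ + i sin θ`. -/
def expIQuat (θ : ℝ) : ℍ[ℝ] := ⟨Real.cos θ, Real.sin θ, 0, 0⟩

theorem expIQuat_mem (θ : ℝ) : expIQuat θ ∈ unitary ℍ[ℝ] := by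
  have h := Real.sin_sq_add_cos_sq θ
  have h0 : (expIQuat θ).re = Real.cos θ := rfl
  have h1 : (expIQuat θ).imI = Real.sin θ := rfl
  have h2 : (expIQuat θ).imJ = 0 := rfl
  have h3 : (expIQuat θ).imK = 0 := rfl
  refine Unitary.mem_iff.mpr ⟨?_, ?_⟩ <;> ext <;> simp [h0, h1, h2, h3] <;> nlinarith

/-- The element `exp(iθ)` of the subgroup `U(1) ⊆ Sp(1)`. -/
def expI (θ : ℝ) : Sp1 := ⟨expIQuat θ, expIQuat_mem θ⟩

/-- The integer `m` is a weight of the complex representation `ρ` of `Sp(1)`: there is a nonzero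
vector on which `exp(iθ) ∈ U(1)` acts as `exp(imθ)`. -/
def HasWeight {W : Type*} [AddCommMonoid W] [Module ℂ W] (ρ : Representation ℂ Sp1 W) (m : ℤ) :
    Prop :=
  ∃ w : W, w ≠ 0 ∧ ∀ θ : ℝ, ρ (expI θ) w = Complex.exp (Complex.I * m * θ) • w

/-- The largest weight of `ρ` is `r`. -/
def HasHighestWeight {W : Type*} [AddCommMonoid W] [Module ℂ W] (ρ : Representation ℂ Sp1 W)
    (r : ℤ) : Prop :=
  HasWeight ρ r ∧ ∀ m : ℤ, HasWeight ρ m → m ≤ r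

section Fibre

variable {V : Type*} [AddCommGroup V] [Module ℝ V] [TopologicalSpace V] {n : ℕ}

/-- The action of a quaternion on `V` obtained from an isomorphism `p : V ≅ ℍⁿ`. -/
def quatAct (p : V ≃L[ℝ] (Fin n → ℍ[ℝ])) (q : ℍ[ℝ]) : V →L[ℝ] V :=
  (p.symm : (Fin n → ℍ[ℝ]) →L[ℝ] V) ∘L leftMul n q ∘L (p : V →L[ℝ] (Fin n → ℍ[ℝ]))

/-- The representation of `Sp(1)` on complex-valued alternating `k`-forms on `V` obtained from an
isomorphism `p : V ≅ ℍⁿ`: `(q α)(v₁, …, v_k) = α(q⁻¹ v₁, …, q⁻¹ v_k)`. -/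
def formRep (p : V ≃L[ℝ] (Fin n → ℍ[ℝ])) (k : ℕ) :
    Representation ℂ Sp1 (V [⋀^Fin k]→L[ℝ] ℂ) where
  toFun q :=
    { toFun := fun α => α.compContinuousLinearMap (quatAct p ((q⁻¹ : Sp1) : ℍ[ℝ]))
      map_add' := fun _ _ => rfl
      map_smul' := fun _ _ => rfl }
  map_one' := by
    ext α v
    simp [quatAct, leftMul, Function.comp_def]
  map_mul' q₁ q₂ := by
    ext α v
    simp [quatAct, leftMul, Function.comp_def, mul_assoc]

/-- The sum of all irreducible `Sp(1)`-subrepresentations of highest weight `r` in the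
complex-valued `k`-forms on `V`, where the `Sp(1)`-action comes from `p : V ≅ ℍⁿ`. -/
def weightForms (p : V ≃L[ℝ] (Fin n → ℍ[ℝ])) (k : ℕ) (r : ℤ) :
    Submodule ℂ (V [⋀^Fin k]→L[ℝ] ℂ) :=
  ⨆ (W : Subrepresentation (formRep p k)) (_ : Representation.IsIrreducible (k := ℂ) (V := W.toSubmodule) W.toRepresentation)
    (_ : HasHighestWeight W.toRepresentation r), W.toSubmodule

/-- The complexification of real-valued `k`-forms, as a real-linear map. -/
def complexify (V : Type*) [AddCommGroup V] [Module ℝ V] [TopologicalSpace V] (k : ℕ) :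
    (V [⋀^Fin k]→L[ℝ] ℝ) →ₗ[ℝ] (V [⋀^Fin k]→L[ℝ] ℂ) where
  toFun α := Complex.ofRealCLM.compContinuousAlternatingMap α
  map_add' α β := by ext v; simp
  map_smul' c α := by ext v; simp

end Fibre

/-! ### Differential forms on a manifold -/

section Forms

variable {E : Type*} [NormedAddCommGroup E] [NormedSpace ℝ E]
  {M : Type*} [TopologicalSpace M] [ChartedSpace E M]
  {F : Type*} [NormedAddCommGroup F] [NormedSpace ℝ F] {k : ℕ}

/-- A (not necessarily smooth) `F`-valued differential `k`-form on `M`. -/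
abbrev DForm (E : Type*) [NormedAddCommGroup E] [NormedSpace ℝ E]
    (M : Type*) [TopologicalSpace M] [ChartedSpace E M]
    (F : Type*) [NormedAddCommGroup F] [NormedSpace ℝ F] (k : ℕ) :=
  ∀ x : M, TangentSpace 𝓘(ℝ, E) x [⋀^Fin k]→L[ℝ] F

/-- The expression of a form in the chart around `x₀`, that is, its pullback under the inverse of
that chart. It is meaningful on the target of the chart. -/
def DForm.inChart (α : DForm E M F k) (x₀ : M) : E → E [⋀^Fin k]→L[ℝ] F := fun y =>
  (α ((extChartAt 𝓘(ℝ, E) x₀).symm y)).compContinuousLinearMap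
    (mfderiv 𝓘(ℝ, E) 𝓘(ℝ, E) (extChartAt 𝓘(ℝ, E) x₀).symm y)

/-- A form is smooth if its expressions in the charts are smooth. -/
def DForm.IsSmooth (α : DForm E M F k) : Prop :=
  ∀ x₀ : M, ContDiffOn ℝ ∞ (α.inChart x₀) (extChartAt 𝓘(ℝ, E) x₀).target

/-- The exterior derivative on `M`, computed at `x` in the chart around `x`. -/
def DForm.d (α : DForm E M F k) : DForm E M F (k + 1) := fun x =>
  (extDeriv (α.inChart x) (extChartAt 𝓘(ℝ, E) x x)).compContinuousLinearMap
    (mfderiv 𝓘(ℝ, E) 𝓘(ℝ, E) (extChartAt 𝓘(ℝ, E) x) x)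

/-- The smooth sections of a family `S` of subspaces of the spaces of `k`-forms. -/
def smoothSections {R : Type*} [Semiring R] [Module R F] [ContinuousConstSMul R F]
    [SMulCommClass ℝ R F]
    (S : ∀ x : M, Submodule R (TangentSpace 𝓘(ℝ, E) x [⋀^Fin k]→L[ℝ] F)) :
    Set (DForm E M F k) :=
  {α | α.IsSmooth ∧ ∀ x, α x ∈ S x}

end Forms

/-! ### `Sp(1) GL(n, ℍ)`-structures and torsion-free connections -/

section Structures

variable {E : Type*} [NormedAddCommGroup E] [NormedSpace ℝ E]
  {M : Type*} [TopologicalSpace M] [ChartedSpace E M] {n : ℕ}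

/-- A choice of a frame `T_xM ≅ ℍⁿ` at each point is smooth on `U` if the vector fields
corresponding to the constant vectors of `ℍⁿ` are smooth on `U`. -/
def IsSmoothFrameOn [IsManifold 𝓘(ℝ, E) 1 M]
    (s : ∀ x : M, TangentSpace 𝓘(ℝ, E) x ≃L[ℝ] (Fin n → ℍ[ℝ])) (U : Set M) : Prop :=
  ∀ v : Fin n → ℍ[ℝ], ContMDiffOn 𝓘(ℝ, E) 𝓘(ℝ, E).tangent ∞
    (fun x => (⟨x, (s x).symm v⟩ : TangentBundle 𝓘(ℝ, E) M)) U

/-- An `Sp(1) GL(n, ℍ)`-structure on `M`: a principal subbundle with this structure group of the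
bundle of frames `T_xM ≅ ℍⁿ`. -/
structure Sp1GLStructure (E : Type*) [NormedAddCommGroup E] [NormedSpace ℝ E]
    (M : Type*) [TopologicalSpace M] [ChartedSpace E M] [IsManifold 𝓘(ℝ, E) 1 M] (n : ℕ) where
  /-- The frames at `x` that belong to the structure. -/
  frames : ∀ x : M, Set (TangentSpace 𝓘(ℝ, E) x ≃L[ℝ] (Fin n → ℍ[ℝ]))
  /-- Each fibre is a single orbit of the group. -/
  mem_iff : ∀ (x : M), ∀ p ∈ frames x, ∀ p' : TangentSpace 𝓘(ℝ, E) x ≃L[ℝ] (Fin n → ℍ[ℝ]),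
    p' ∈ frames x ↔ ∃ g ∈ sp1GL n, p' = p.trans g
  /-- There are smooth local sections around every point. -/
  exists_section : ∀ x₀ : M, ∃ (U : Set M)
    (s : ∀ x : M, TangentSpace 𝓘(ℝ, E) x ≃L[ℝ] (Fin n → ℍ[ℝ])),
    IsOpen U ∧ x₀ ∈ U ∧ (∀ x ∈ U, s x ∈ frames x) ∧ IsSmoothFrameOn s U

/-- The linear connection `∇` preserves the structure `Q`: in every smooth local section `s` of `Q`
the connection form of `∇` takes values in the Lie algebra of `Sp(1) GL(n, ℍ)`. -/
def Preserves [IsManifold 𝓘(ℝ, E) 1 M] (Q : Sp1GLStructure E M n)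
    (cov : CovariantDerivative 𝓘(ℝ, E) E (TangentSpace 𝓘(ℝ, E) : M → Type _)) : Prop :=
  ∀ (U : Set M) (s : ∀ x : M, TangentSpace 𝓘(ℝ, E) x ≃L[ℝ] (Fin n → ℍ[ℝ])),
    IsOpen U → (∀ x ∈ U, s x ∈ Q.frames x) → IsSmoothFrameOn s U →
    ∀ x ∈ U, ∀ X : TangentSpace 𝓘(ℝ, E) x,
      (fun v => s x (cov (fun y => (s y).symm v) x X)) ∈ sp1glAlgebra n

/-- `Q` admits a (smooth) torsion-free connection. -/
def AdmitsTorsionFreeConnection [FiniteDimensional ℝ E] [CompleteSpace E]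
    [IsManifold 𝓘(ℝ, E) ∞ M] (Q : Sp1GLStructure E M n) : Prop :=
  ∃ cov : CovariantDerivative 𝓘(ℝ, E) E (TangentSpace 𝓘(ℝ, E) : M → Type _),
    CovariantDerivative.ContMDiffCovariantDerivative cov ∞ ∧ cov.torsion = 0 ∧ Preserves Q cov

/-- The fibre at `x` of the bundle `E_{k,r}` of complex-valued forms: the forms lying in
`Sp(1)`-representations of highest weight `r`. The `Sp(1)`-action depends on a frame in `Q`;
the resulting subspace does not. -/
def bundleC [IsManifold 𝓘(ℝ, E) 1 M] (Q : Sp1GLStructure E M n) (k : ℕ) (r : ℤ) (x : M) :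
    Submodule ℂ (TangentSpace 𝓘(ℝ, E) x [⋀^Fin k]→L[ℝ] ℂ) :=
  ⨆ p ∈ Q.frames x, weightForms p k r

/-- The fibre at `x` of the bundle `E_{k,r}` of real-valued forms: the forms whose complexification
lies in Sp(1)-representations of highest weight `r`. -/
def bundleR [IsManifold 𝓘(ℝ, E) 1 M] (Q : Sp1GLStructure E M n) (k : ℕ) (r : ℤ) (x : M) :
    Submodule ℝ (TangentSpace 𝓘(ℝ, E) x [⋀^Fin k]→L[ℝ] ℝ) :=
  ((bundleC Q k r x).restrictScalars ℝ).comap (complexify (TangentSpace 𝓘(ℝ, E) x) k)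

end Structures

end

end QuatDolbeault

/-! The argument replaces highest weights by eigenvalues. Let `D_a` be the infinitesimal action on
forms of left multiplication by `a`, and `C = -(D_i² + D_j² + D_k²)` the Casimir operator. On an
irreducible representation of highest weight `r` it is the scalar `r(r+2)`. The action on forms over
`ℍⁿ` is unitary, hence completely reducible, so for `r ≥ -1` the isotypic component is exactly the
eigenspace of `C` (`mem_isotypic_stdRep_iff`). Pullback along `Sp(1)GL(n, ℍ)` commutes with `C`, so
the fibre of `E_{k,r}` can be tested in any single frame of `Q` (`mem_bundleC_iff`). The Lie algebra
preserves the eigenspaces for the same reason (`lieDer_mem_isotypic`).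

In a local section of `Q`, a torsion-free connection expresses `dα` as the alternation of `T = ∇α`
(`exists_extDeriv_comp_eq`). Each `T w` is the derivative of a function with values in the isotypic
component, plus the action of the connection form, which preserves that component; so `T` takes
values in it (`exists_d_comp_frameInv`). What remains is the Clebsch–Gordan rule for `(ℍⁿ)* ⊗ Λᵏ`,
where the first factor has weight one. The cross term `M` of the Casimir operator of the tensor
product satisfies `M² = C - 2M`. On weight `r` this leaves the roots `r` and `-(r+2)`, which give
the Casimir eigenvalues `(r+1)(r+3)` and `(r-1)(r+1)`, that is, weights `r+1` and `r-1`
(`exists_casimir_decomposition`).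

For `n = 1` no connection is needed. Forms on `ℍ` have weights `0`; `1`; `2, 0`; `1` in degrees `0,
…, 3` and vanish above degree four, so one nonzero value of `α` determines `r` well enough that
every `(k+1)`-form is allowed (`mem_of_exists_ne_zero`).

The two target components belong to distinct eigenvalues, or one of them is zero, so their sum is
direct. Since `C` commutes with conjugation, the components of a real form are real
(`mem_bundleR_sup`). -/

namespace QuatDolbeault

noncomputable section

/-! ### The derivation action of endomorphisms on forms -/

section Derivation

variable {V : Type*} [NormedAddCommGroup V] [NormedSpace ℝ V] {k : ℕ}

/-- The infinitesimal action of an endomorphism `A` on forms: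
`(A α)(v₁, …, v_k) = -∑ i, α(v₁, …, A vᵢ, …, v_k)`. -/
def lieDer (A : V →L[ℝ] V) : (V [⋀^Fin k]→L[ℝ] ℂ) →ₗ[ℂ] (V [⋀^Fin k]→L[ℝ] ℂ) where
  toFun α := -α.fderivCompContinuousLinearMap (.id ℝ V) A
  map_add' α β := by
    ext v
    simp [Finset.sum_add_distrib]
    ring
  map_smul' c α := by
    ext v
    simp [Finset.mul_sum]

theorem lieDer_eq (A : V →L[ℝ] V) (α : V [⋀^Fin k]→L[ℝ] ℂ) :
    lieDer A α = -α.fderivCompContinuousLinearMap (.id ℝ V) A := rfl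

theorem lieDer_apply (A : V →L[ℝ] V) (α : V [⋀^Fin k]→L[ℝ] ℂ) (v : Fin k → V) :
    lieDer A α v = -∑ i, α (Function.update v i (A (v i))) := by
  rw [lieDer_eq, ContinuousAlternatingMap.neg_apply,
    ContinuousAlternatingMap.fderivCompContinuousLinearMap_apply]
  congr 1
  refine Finset.sum_congr rfl fun i _ => congrArg α (funext fun j => ?_)
  rcases eq_or_ne j i with rfl | h <;> simp [*]

theorem lieDer_add (A B : V →L[ℝ] V) (α : V [⋀^Fin k]→L[ℝ] ℂ) :
    lieDer (A + B) α = lieDer A α + lieDer B α := by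
  simp only [lieDer_eq, map_add, neg_add]

theorem lieDer_smul (c : ℝ) (A : V →L[ℝ] V) (α : V [⋀^Fin k]→L[ℝ] ℂ) :
    lieDer (c • A) α = c • lieDer A α := by
  simp only [lieDer_eq, map_smul, smul_neg]

/-- The infinitesimal action is a Lie algebra action. -/
theorem lieDer_lieDer_sub (A B : V →L[ℝ] V) (α : V [⋀^Fin k]→L[ℝ] ℂ) :
    lieDer A (lieDer B α) - lieDer B (lieDer A α) = lieDer (A ∘L B - B ∘L A) α := by
  -- The diagonal terms put both endomorphisms in one slot and yield the commutator; the terms with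
  -- two different slots are symmetric in `A` and `B` and cancel.
  have key (A B : V →L[ℝ] V) (v : Fin k → V) : lieDer A (lieDer B α) v =
      ∑ i, α (Function.update v i (B (A (v i)))) + ∑ i, ∑ j with j ≠ i,
        α (Function.update (Function.update v i (A (v i))) j (B (v j))) := by
    simp only [lieDer_apply, Finset.sum_neg_distrib, neg_neg]
    rw [← Finset.sum_add_distrib]
    refine Finset.sum_congr rfl fun i _ => ?_
    rw [← Finset.sum_filter_add_sum_filter_not Finset.univ (fun j => j = i)]
    congr 1
    · simp [Finset.filter_eq']
    · refine Finset.sum_congr rfl fun j hj => ?_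
      rw [Function.update_of_ne (by simpa using hj)]
  have swap (v : Fin k → V) : (∑ i, ∑ j with j ≠ i,
        α (Function.update (Function.update v i (A (v i))) j (B (v j)))) =
      ∑ i, ∑ j with j ≠ i,
        α (Function.update (Function.update v i (B (v i))) j (A (v j))) := by
    simp only [Finset.sum_filter]
    rw [Finset.sum_comm]
    refine Finset.sum_congr rfl fun i _ => Finset.sum_congr rfl fun j _ => ?_
    by_cases h : j = i
    · simp [h]
    · rw [if_pos h, if_pos (Ne.symm h), Function.update_comm h]
  ext v
  rw [ContinuousAlternatingMap.sub_apply, key, key, swap, lieDer_apply]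
  simp only [sub_apply, ContinuousAlternatingMap.map_update_sub,
    Finset.sum_sub_distrib, ContinuousLinearMap.comp_apply]
  ring

/-- Naturality of the infinitesimal action under pullback. -/
theorem lieDer_compContinuousLinearMap {W : Type*} [NormedAddCommGroup W] [NormedSpace ℝ W]
    {A : V →L[ℝ] V} {B : W →L[ℝ] W} {g : V →L[ℝ] W} (h : g ∘L A = B ∘L g)
    (α : W [⋀^Fin k]→L[ℝ] ℂ) :
    lieDer A (α.compContinuousLinearMap g) = (lieDer B α).compContinuousLinearMap g := by
  ext v
  simp only [lieDer_apply, ContinuousAlternatingMap.compContinuousLinearMap_apply]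
  congr 1
  refine Finset.sum_congr rfl fun i _ => congrArg α ?_
  rw [Function.comp_update]
  congr 1
  exact DFunLike.congr_fun h (v i)

/-- The infinitesimal action as a real continuous linear map. -/
def lieDerCLM (A : V →L[ℝ] V) : (V [⋀^Fin k]→L[ℝ] ℂ) →L[ℝ] (V [⋀^Fin k]→L[ℝ] ℂ) :=
  -(ContinuousLinearMap.apply ℝ _ A ∘L
    ContinuousAlternatingMap.fderivCompContinuousLinearMapCLM ℂ (.id ℝ V))

@[simp]
theorem lieDerCLM_apply (A : V →L[ℝ] V) (α : V [⋀^Fin k]→L[ℝ] ℂ) :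
    lieDerCLM A α = lieDer A α := rfl

/-- The alternation map intertwines the infinitesimal actions. -/
theorem lieDer_alternatizeUncurryFin (A : V →L[ℝ] V)
    (T : V →L[ℝ] V [⋀^Fin k]→L[ℝ] ℂ) :
    lieDer A (ContinuousAlternatingMap.alternatizeUncurryFin T) =
      ContinuousAlternatingMap.alternatizeUncurryFin (lieDerCLM A ∘L T - T ∘L A) := by
  ext v
  simp only [lieDer_apply, ContinuousAlternatingMap.alternatizeUncurryFin_apply]
  rw [Finset.sum_comm, ← Finset.sum_neg_distrib]
  refine Finset.sum_congr rfl fun l _ => ?_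
  -- The slot `l` that is fed to `T` produces `T ∘ A`; the remaining slots produce the action on the
  -- values of `T`.
  rw [Fin.sum_univ_succAbove _ l]
  simp only [sub_apply, ContinuousLinearMap.comp_apply, lieDerCLM_apply,
    ContinuousAlternatingMap.sub_apply, lieDer_apply, Function.update_self, Fin.removeNth_update]
  rw [smul_sub, smul_neg, Finset.smul_sum, neg_add, sub_eq_neg_add]
  congr 2
  refine Finset.sum_congr rfl fun j _ => ?_
  rw [Function.update_of_ne (Fin.ne_succAbove l j)]
  congr 2
  ext m
  rcases eq_or_ne m j with rfl | h
  · simp [Fin.removeNth]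
  · simp [Fin.removeNth, h]

end Derivation

/-! ### The Casimir operator -/

section Casimir

variable {n k : ℕ}

theorem leftMul_apply (q : ℍ[ℝ]) (v : Fin n → ℍ[ℝ]) (i : Fin n) : leftMul n q v i = q * v i := rfl

theorem leftMul_mul (a b : ℍ[ℝ]) : leftMul n (a * b) = leftMul n a ∘L leftMul n b := by
  ext1 v; funext i; simp [leftMul_apply, mul_assoc]

theorem leftMul_add (a b : ℍ[ℝ]) : leftMul n (a + b) = leftMul n a + leftMul n b := by
  ext1 v; funext i; simp [leftMul_apply, add_mul]

theorem leftMul_sub (a b : ℍ[ℝ]) : leftMul n (a - b) = leftMul n a - leftMul n b := by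
  ext1 v; funext i; simp [leftMul_apply, sub_mul]

theorem leftMul_smul (c : ℝ) (a : ℍ[ℝ]) : leftMul n (c • a) = c • leftMul n a := by
  ext1 v; funext i; simp [leftMul_apply]

theorem leftMul_one : leftMul n 1 = .id ℝ _ := by
  ext1 v; funext i; simp [leftMul_apply]

/-- The quaternion unit `i`. -/
def qI : ℍ[ℝ] := ⟨0, 1, 0, 0⟩

/-- The quaternion unit `j`. -/
def qJ : ℍ[ℝ] := ⟨0, 0, 1, 0⟩

/-- The quaternion unit `k`. -/
def qK : ℍ[ℝ] := ⟨0, 0, 0, 1⟩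

@[simp] theorem qI_re : qI.re = 0 := rfl
@[simp] theorem qI_imI : qI.imI = 1 := rfl
@[simp] theorem qI_imJ : qI.imJ = 0 := rfl
@[simp] theorem qI_imK : qI.imK = 0 := rfl
@[simp] theorem qJ_re : qJ.re = 0 := rfl
@[simp] theorem qJ_imI : qJ.imI = 0 := rfl
@[simp] theorem qJ_imJ : qJ.imJ = 1 := rfl
@[simp] theorem qJ_imK : qJ.imK = 0 := rfl
@[simp] theorem qK_re : qK.re = 0 := rfl
@[simp] theorem qK_imI : qK.imI = 0 := rfl
@[simp] theorem qK_imJ : qK.imJ = 0 := rfl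
@[simp] theorem qK_imK : qK.imK = 1 := rfl

theorem qI_mul_qI : qI * qI = -1 := by ext <;> simp
theorem qJ_mul_qJ : qJ * qJ = -1 := by ext <;> simp
theorem qK_mul_qK : qK * qK = -1 := by ext <;> simp
theorem qI_mul_qJ : qI * qJ = qK := by ext <;> simp
theorem qJ_mul_qK : qJ * qK = qI := by ext <;> simp
theorem qK_mul_qI : qK * qI = qJ := by ext <;> simp
theorem qJ_mul_qI : qJ * qI = -qK := by ext <;> simp
theorem qK_mul_qJ : qK * qJ = -qI := by ext <;> simp
theorem qI_mul_qK : qI * qK = -qJ := by ext <;> simp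

variable (n k) in
/-- The complex-valued `k`-forms on `ℍⁿ`. -/
abbrev QForm : Type := (Fin n → ℍ[ℝ]) [⋀^Fin k]→L[ℝ] ℂ

/-- The infinitesimal action of a quaternion on the forms on `ℍⁿ`. -/
def quatDer (a : ℍ[ℝ]) : QForm n k →ₗ[ℂ] QForm n k := lieDer (leftMul n a)

theorem quatDer_add (a b : ℍ[ℝ]) (α : QForm n k) :
    quatDer (a + b) α = quatDer a α + quatDer b α := by
  rw [quatDer, leftMul_add, lieDer_add]; rfl

theorem quatDer_smul (c : ℝ) (a : ℍ[ℝ]) (α : QForm n k) :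
    quatDer (c • a) α = c • quatDer a α := by
  rw [quatDer, leftMul_smul, lieDer_smul]; rfl

theorem quatDer_commutator (a b : ℍ[ℝ]) (α : QForm n k) :
    quatDer a (quatDer b α) - quatDer b (quatDer a α) = quatDer (a * b - b * a) α := by
  rw [quatDer, quatDer, quatDer, lieDer_lieDer_sub, leftMul_sub, leftMul_mul, leftMul_mul]

/-- The bracket relation `[i, j] = 2k`, oriented as a rewriting rule; together with its two cyclic
companions it puts products of two derivations into a normal order. -/
theorem quatDer_qI_qJ (α : QForm n k) :
    quatDer qI (quatDer qJ α) = quatDer qJ (quatDer qI α) + (2 : ℂ) • quatDer qK α := by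
  have h := quatDer_commutator qI qJ α
  rw [qI_mul_qJ, qJ_mul_qI, show qK - -qK = qK + qK by abel, quatDer_add] at h
  rw [sub_eq_iff_eq_add'.1 h]
  module

theorem quatDer_qJ_qK (α : QForm n k) :
    quatDer qJ (quatDer qK α) = quatDer qK (quatDer qJ α) + (2 : ℂ) • quatDer qI α := by
  have h := quatDer_commutator qJ qK α
  rw [qJ_mul_qK, qK_mul_qJ, show qI - -qI = qI + qI by abel, quatDer_add] at h
  rw [sub_eq_iff_eq_add'.1 h]
  module

theorem quatDer_qK_qI (α : QForm n k) :
    quatDer qK (quatDer qI α) = quatDer qI (quatDer qK α) + (2 : ℂ) • quatDer qJ α := by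
  have h := quatDer_commutator qK qI α
  rw [qK_mul_qI, qI_mul_qK, show qJ - -qJ = qJ + qJ by abel, quatDer_add] at h
  rw [sub_eq_iff_eq_add'.1 h]
  module

variable (n k) in
/-- The Casimir operator of `𝔰𝔭(1)` on the forms on `ℍⁿ`. -/
def casimir : QForm n k →ₗ[ℂ] QForm n k :=
  -(quatDer qI ∘ₗ quatDer qI + quatDer qJ ∘ₗ quatDer qJ + quatDer qK ∘ₗ quatDer qK)

theorem casimir_apply (α : QForm n k) : casimir n k α =
    -(quatDer qI (quatDer qI α) + quatDer qJ (quatDer qJ α) + quatDer qK (quatDer qK α)) := rfl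

theorem casimir_quatDer_qI (α : QForm n k) :
    casimir n k (quatDer qI α) = quatDer qI (casimir n k α) := by
  simp only [casimir_apply, quatDer_qK_qI, quatDer_qI_qJ, map_add, map_neg, map_smul]
  module

theorem casimir_quatDer_qJ (α : QForm n k) :
    casimir n k (quatDer qJ α) = quatDer qJ (casimir n k α) := by
  simp only [casimir_apply, quatDer_qJ_qK, quatDer_qI_qJ, map_add, map_neg, map_smul]
  module

theorem casimir_quatDer_qK (α : QForm n k) :
    casimir n k (quatDer qK α) = quatDer qK (casimir n k α) := by
  simp only [casimir_apply, quatDer_qJ_qK, quatDer_qK_qI, map_add, map_neg, map_smul]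
  module

theorem eq_units_of_re_eq_zero {a : ℍ[ℝ]} (ha : a.re = 0) :
    a = a.imI • qI + a.imJ • qJ + a.imK • qK := by
  ext <;> simp [ha]

theorem quatDer_eq_units {a : ℍ[ℝ]} (ha : a.re = 0) (α : QForm n k) :
    quatDer a α = a.imI • quatDer qI α + a.imJ • quatDer qJ α + a.imK • quatDer qK α := by
  conv_lhs => rw [eq_units_of_re_eq_zero ha]
  simp only [quatDer_add, quatDer_smul]

theorem real_smul_eq (c : ℝ) (α : QForm n k) : c • α = (c : ℂ) • α := by
  ext v; simp

theorem casimir_quatDer {a : ℍ[ℝ]} (ha : a.re = 0) (α : QForm n k) :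
    casimir n k (quatDer a α) = quatDer a (casimir n k α) := by
  simp only [quatDer_eq_units ha, real_smul_eq, map_add, map_smul, casimir_quatDer_qI,
    casimir_quatDer_qJ, casimir_quatDer_qK]

/-- Endomorphisms commuting with the quaternions commute with the Casimir operator. -/
theorem casimir_lieDer {B : (Fin n → ℍ[ℝ]) →L[ℝ] (Fin n → ℍ[ℝ])}
    (hB : ∀ a, B ∘L leftMul n a = leftMul n a ∘L B) (α : QForm n k) :
    casimir n k (lieDer B α) = lieDer B (casimir n k α) := by
  have h (a : ℍ[ℝ]) (α : QForm n k) : quatDer a (lieDer B α) = lieDer B (quatDer a α) := by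
    have := lieDer_lieDer_sub (leftMul n a) B α
    rw [hB, sub_self, lieDer_eq 0, map_zero, neg_zero] at this
    exact sub_eq_zero.1 this
  simp only [casimir_apply, h, map_add, map_neg]

/-- Pullback along an isomorphism that commutes with the quaternions commutes with the Casimir
operator. -/
theorem casimir_comp_of_commute {B : (Fin n → ℍ[ℝ]) →L[ℝ] (Fin n → ℍ[ℝ])}
    (hB : ∀ a, B ∘L leftMul n a = leftMul n a ∘L B) (α : QForm n k) :
    casimir n k (α.compContinuousLinearMap B) = (casimir n k α).compContinuousLinearMap B := by
  have h (a : ℍ[ℝ]) (α : QForm n k) :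
      quatDer a (α.compContinuousLinearMap B) = (quatDer a α).compContinuousLinearMap B :=
    lieDer_compContinuousLinearMap (hB a) α
  simp only [casimir_apply, h]
  rfl

/-- Pullback along multiplication by a unit quaternion commutes with the Casimir operator. -/
theorem casimir_comp_leftMul {q : ℍ[ℝ]} (hq : q ∈ unitary ℍ[ℝ]) (α : QForm n k) :
    casimir n k (α.compContinuousLinearMap (leftMul n q)) =
      (casimir n k α).compContinuousLinearMap (leftMul n q) := by
  -- Pullback by `q` conjugates the acting quaternion, since `q a = (q a q̄) q`.
  have h (a : ℍ[ℝ]) (α : QForm n k) : quatDer a (α.compContinuousLinearMap (leftMul n q)) =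
      (quatDer (q * a * star q) α).compContinuousLinearMap (leftMul n q) := by
    refine lieDer_compContinuousLinearMap ?_ α
    rw [← leftMul_mul, ← leftMul_mul, mul_assoc, Unitary.star_mul_self_of_mem hq, mul_one]
  have hre (a : ℍ[ℝ]) (ha : a.re = 0) : (q * a * star q).re = 0 := by
    simp [ha]; ring
  have hq1 : q.re ^ 2 + q.imI ^ 2 + q.imJ ^ 2 + q.imK ^ 2 = 1 := by
    have := congrArg (fun z : ℍ[ℝ] => z.re) (Unitary.star_mul_self_of_mem hq)
    simp at this
    nlinarith
  -- Conjugation by a unit quaternion rotates `i, j, k` orthogonally, and a sum of squares over an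
  -- orthonormal frame does not change.
  have key : quatDer (q * qI * star q) (quatDer (q * qI * star q) α) +
      quatDer (q * qJ * star q) (quatDer (q * qJ * star q) α) +
      quatDer (q * qK * star q) (quatDer (q * qK * star q) α) =
      quatDer qI (quatDer qI α) + quatDer qJ (quatDer qJ α) + quatDer qK (quatDer qK α) := by
    simp only [quatDer_eq_units (hre qI rfl), quatDer_eq_units (hre qJ rfl),
      quatDer_eq_units (hre qK rfl), real_smul_eq, map_add, map_smul]
    have hqC : (q.re : ℂ) ^ 2 + (q.imI : ℂ) ^ 2 + (q.imJ : ℂ) ^ 2 + (q.imK : ℂ) ^ 2 = 1 := by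
      exact_mod_cast hq1
    simp only [Quaternion.imI_mul, Quaternion.imJ_mul, Quaternion.imK_mul, Quaternion.re_mul,
      Quaternion.re_star, Quaternion.imI_star, Quaternion.imJ_star, Quaternion.imK_star, qI_re,
      qI_imI, qI_imJ, qI_imK, qJ_re, qJ_imI, qJ_imJ, qJ_imK, qK_re, qK_imI, qK_imJ, qK_imK]
    push_cast
    match_scalars
    all_goals first
      | ring1
      -- The diagonal coefficients equal `|q|⁴`, and `|q|⁴ - 1 = (1 + |q|²)(|q|² - 1)`.
      | linear_combination (1 + (q.re : ℂ) ^ 2 + (q.imI : ℂ) ^ 2 + (q.imJ : ℂ) ^ 2 +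
          (q.imK : ℂ) ^ 2) * hqC
  simp only [casimir_apply, h, ← key]
  rfl

end Casimir

/-! ### The Clebsch–Gordan decomposition -/

section ClebschGordan

open ContinuousAlternatingMap

variable {n k : ℕ}

/-- The infinitesimal action of a quaternion as a real continuous linear map. -/
def quatDerCLM (a : ℍ[ℝ]) : QForm n k →L[ℝ] QForm n k := lieDerCLM (leftMul n a)

@[simp]
theorem quatDerCLM_apply (a : ℍ[ℝ]) (α : QForm n k) : quatDerCLM a α = quatDer a α := rfl

theorem quatDer_alternatizeUncurryFin (a : ℍ[ℝ]) (T : (Fin n → ℍ[ℝ]) →L[ℝ] QForm n k) :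
    quatDer a (alternatizeUncurryFin T) =
      alternatizeUncurryFin (quatDerCLM a ∘L T - T ∘L leftMul n a) :=
  lieDer_alternatizeUncurryFin _ T

theorem alternatizeUncurryFin_neg {V : Type*} [NormedAddCommGroup V] [NormedSpace ℝ V]
    {F : Type*} [NormedAddCommGroup F] [NormedSpace ℝ F] (T : V →L[ℝ] V [⋀^Fin k]→L[ℝ] F) :
    alternatizeUncurryFin (-T) = -alternatizeUncurryFin T := by
  ext v
  simp [alternatizeUncurryFin_apply]

/-- The mixed term of the Casimir operator on `(ℍⁿ)* ⊗ Λᵏ`. -/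
def casimirMixed (T : (Fin n → ℍ[ℝ]) →L[ℝ] QForm n k) : (Fin n → ℍ[ℝ]) →L[ℝ] QForm n k :=
  quatDerCLM qI ∘L T ∘L leftMul n qI + quatDerCLM qJ ∘L T ∘L leftMul n qJ +
    quatDerCLM qK ∘L T ∘L leftMul n qK

theorem casimirMixed_apply (T : (Fin n → ℍ[ℝ]) →L[ℝ] QForm n k) (v : Fin n → ℍ[ℝ]) :
    casimirMixed T v = quatDer qI (T (leftMul n qI v)) + quatDer qJ (T (leftMul n qJ v)) +
      quatDer qK (T (leftMul n qK v)) := rfl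

theorem leftMul_leftMul (a b : ℍ[ℝ]) (v : Fin n → ℍ[ℝ]) :
    leftMul n a (leftMul n b v) = leftMul n (a * b) v := by
  rw [leftMul_mul]; rfl

theorem leftMul_neg_apply (a : ℍ[ℝ]) (v : Fin n → ℍ[ℝ]) :
    leftMul n (-a) v = -leftMul n a v := by
  funext i; simp [leftMul_apply]

theorem leftMul_one_apply (v : Fin n → ℍ[ℝ]) : leftMul n 1 v = v := by rw [leftMul_one]; rfl

/-- In `∑ D_u D_{u'} T(u' u v)` the diagonal terms have `u² = -1` and sum to the Casimir operator.
The terms for `(i, j)` and `(j, i)` combine to `-[D_i, D_j] T(kv) = -2 D_k T(kv)`, and cyclically.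
-/
theorem casimirMixed_casimirMixed_apply (T : (Fin n → ℍ[ℝ]) →L[ℝ] QForm n k)
    (v : Fin n → ℍ[ℝ]) :
    casimirMixed (casimirMixed T) v = casimir n k (T v) - (2 : ℂ) • casimirMixed T v := by
  simp only [casimirMixed_apply, leftMul_leftMul, qI_mul_qI, qJ_mul_qJ, qK_mul_qK, qI_mul_qJ,
    qJ_mul_qK, qK_mul_qI, qJ_mul_qI, qK_mul_qJ, qI_mul_qK, leftMul_neg_apply, leftMul_one_apply,
    map_neg, map_add, casimir_apply, quatDer_qI_qJ, quatDer_qJ_qK, quatDer_qK_qI]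
  module

/-- The action of `u` on `T` is `D_u T - T u`, with square `D_u² T - 2 D_u T u + T u²`. Summing over
the three units and changing sign, `u² = -1` contributes the `3` and the cross terms contribute
twice the mixed operator. -/
theorem casimir_alternatizeUncurryFin {T : (Fin n → ℍ[ℝ]) →L[ℝ] QForm n k} {c : ℂ}
    (hT : ∀ v, casimir n k (T v) = c • T v) :
    casimir n (k + 1) (alternatizeUncurryFin T) =
      (c + 3) • alternatizeUncurryFin T + (2 : ℂ) • alternatizeUncurryFin (casimirMixed T) := by
  simp only [casimir_apply, quatDer_alternatizeUncurryFin]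
  rw [← alternatizeUncurryFin_add, ← alternatizeUncurryFin_add, ← alternatizeUncurryFin_smul,
    ← alternatizeUncurryFin_smul, ← alternatizeUncurryFin_add, ← alternatizeUncurryFin_neg]
  congr 1
  refine ContinuousLinearMap.ext fun v => ?_
  have h := hT v
  rw [casimir_apply] at h
  simp only [_root_.neg_apply, _root_.add_apply, _root_.sub_apply,
    ContinuousLinearMap.comp_apply, _root_.smul_apply, quatDerCLM_apply,
    casimirMixed_apply, leftMul_leftMul, qI_mul_qI, qJ_mul_qJ, qK_mul_qK,
    leftMul_neg_apply, leftMul_one_apply]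
  simp only [map_neg, map_sub, add_smul, ← h]
  module

/-- On the span of `ζ` and `η` the hypotheses make `C` act by a two-by-two matrix with eigenvalues
`(r+1)(r+3)` and `(r-1)(r+1)`. -/
theorem exists_eigen_decomposition {X : Type*} [AddCommGroup X] [Module ℂ X] {C : X →ₗ[ℂ] X}
    {ζ η : X} {r : ℤ} (hr : 0 ≤ r) (hζ : C ζ = (r * (r + 2) + 3 : ℂ) • ζ + (2 : ℂ) • η)
    (hη : C η = (r * (r + 2) + 3 : ℂ) • η +
      (2 : ℂ) • ((r * (r + 2) : ℂ) • ζ + (-2 : ℂ) • η)) :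
    ∃ β γ : X, ζ = β + γ ∧ C β = ((r + 1) * (r + 3) : ℂ) • β ∧
      C γ = ((r - 1) * (r + 1) : ℂ) • γ := by
  have hr' : (4 * r + 4 : ℂ) ≠ 0 := by
    have : (4 * r + 4 : ℤ) ≠ 0 := by omega
    exact_mod_cast this
  -- The witnesses are the spectral projections of `ζ`: each is `C` minus the other eigenvalue
  -- applied to `ζ`, up to sign, divided by the gap `4r + 4` between the two eigenvalues.
  refine ⟨(4 * r + 4 : ℂ)⁻¹ • ((2 : ℂ) • η + (2 * r + 4 : ℂ) • ζ),
    (4 * r + 4 : ℂ)⁻¹ • ((2 * r : ℂ) • ζ - (2 : ℂ) • η), ?_, ?_, ?_⟩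
  · rw [← smul_add, eq_inv_smul_iff₀ hr']
    module
  · rw [map_smul, smul_comm]
    congr 1
    simp only [map_add, map_smul, hζ, hη]
    module
  · rw [map_smul, smul_comm]
    congr 1
    simp only [map_sub, map_smul, hζ, hη]
    module

/-- Tensoring with `(ℍⁿ)*` and alternating changes the highest weight by one. -/
theorem exists_casimir_decomposition {T : (Fin n → ℍ[ℝ]) →L[ℝ] QForm n k} {r : ℤ} (hr : 0 ≤ r)
    (hT : ∀ v, casimir n k (T v) = (r * (r + 2) : ℂ) • T v) :
    ∃ β γ : QForm n (k + 1), alternatizeUncurryFin T = β + γ ∧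
      casimir n (k + 1) β = ((r + 1) * (r + 3) : ℂ) • β ∧
      casimir n (k + 1) γ = ((r - 1) * (r + 1) : ℂ) • γ := by
  -- The mixed operator keeps values in the eigenspace, so the Casimir formula applies to it as
  -- well.
  have hT1 (v) : casimir n k (casimirMixed T v) = (r * (r + 2) : ℂ) • casimirMixed T v := by
    simp only [casimirMixed_apply, map_add, casimir_quatDer_qI, casimir_quatDer_qJ,
      casimir_quatDer_qK, hT, map_smul, smul_add]
  have h0 := casimir_alternatizeUncurryFin hT
  have h1 := casimir_alternatizeUncurryFin hT1
  have h2 : casimirMixed (casimirMixed T) = (r * (r + 2) : ℂ) • T + (-2 : ℂ) • casimirMixed T := by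
    refine ContinuousLinearMap.ext fun v => ?_
    rw [casimirMixed_casimirMixed_apply, hT]
    simp only [_root_.add_apply, _root_.smul_apply]
    module
  rw [h2, alternatizeUncurryFin_add, alternatizeUncurryFin_smul,
    alternatizeUncurryFin_smul] at h1
  set ζ := alternatizeUncurryFin T
  set η := alternatizeUncurryFin (casimirMixed T)
  exact exists_eigen_decomposition hr h0 h1

end ClebschGordan

/-! ### Isotypic components and the Casimir operator -/

section Isotypic

/-- The sum of the irreducible subrepresentations of highest weight `r`. -/
def isotypic {X : Type*} [AddCommGroup X] [Module ℂ X] (ρ : Representation ℂ Sp1 X) (r : ℤ) :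
    Submodule ℂ X :=
  ⨆ (W : Subrepresentation ρ)
    (_ : Representation.IsIrreducible (k := ℂ) (V := W.toSubmodule) W.toRepresentation)
    (_ : HasHighestWeight W.toRepresentation r), W.toSubmodule

variable {X : Type*} [NormedAddCommGroup X] [NormedSpace ℝ X] [NormedSpace ℂ X]
  {ρ : Representation ℂ Sp1 X}

/-- The infinitesimal action of `𝔰𝔭(1)` belonging to a representation of `Sp(1)`, together with
the invariance properties that make the representation semisimple. -/
structure InfAction (ρ : Representation ℂ Sp1 X) where
  /-- The action of `i`. -/
  I : X →ₗ[ℂ] X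
  /-- The action of `j`. -/
  J : X →ₗ[ℂ] X
  /-- The action of `k`. -/
  K : X →ₗ[ℂ] X
  -- For `i` the derivative is required at every `θ`, in order to integrate an eigenvector to a
  -- weight vector of `U(1)`. For `j` and `k` the derivative at `0` suffices, because only
  -- invariance of subrepresentations is drawn from it.
  hasDerivAt_I : ∀ x θ, HasDerivAt (fun t : ℝ => ρ (expI t) x) (ρ (expI θ) (I x)) θ
  exists_J : ∃ c : ℝ → Sp1, ∀ x, HasDerivAt (fun t : ℝ => ρ (c t) x) (J x) 0
  exists_K : ∃ c : ℝ → Sp1, ∀ x, HasDerivAt (fun t : ℝ => ρ (c t) x) (K x) 0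
  comm_IJ : ∀ x, I (J x) = J (I x) + (2 : ℂ) • K x
  comm_JK : ∀ x, J (K x) = K (J x) + (2 : ℂ) • I x
  comm_KI : ∀ x, K (I x) = I (K x) + (2 : ℂ) • J x
  casimir_comm : ∀ q x, (I ∘ₗ I + J ∘ₗ J + K ∘ₗ K) (ρ q x) = ρ q ((I ∘ₗ I + J ∘ₗ J + K ∘ₗ K) x)
  exists_isCompl : ∀ U : Subrepresentation ρ, ∃ U' : Subrepresentation ρ,
    IsCompl U.toSubmodule U'.toSubmodule

theorem expI_zero : expI 0 = 1 := by
  ext <;> simp [expI, expIQuat]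

theorem expI_two_pi : expI (2 * Real.pi) = 1 := by
  ext <;> simp [expI, expIQuat]

/-- The quaternion `j` as an element of `Sp(1)`. -/
def unitJ : Sp1 := ⟨qJ, by
  refine Unitary.mem_iff.mpr ⟨?_, ?_⟩ <;> ext <;> simp⟩

/-- The quaternion `j` represents the nontrivial Weyl group element: it reverses weights. -/
theorem expI_mul_unitJ (θ : ℝ) : expI θ * unitJ = unitJ * expI (-θ) := by
  have h0 (t : ℝ) : (expIQuat t).re = Real.cos t := rfl
  have h1 (t : ℝ) : (expIQuat t).imI = Real.sin t := rfl
  have h2 (t : ℝ) : (expIQuat t).imJ = 0 := rfl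
  have h3 (t : ℝ) : (expIQuat t).imK = 0 := rfl
  ext <;> simp [expI, unitJ, h0, h1, h2, h3]

/-- Applying `j` to a vector of weight `r` gives one of weight `-r`, so maximality forces `-r ≤ r`.
-/
theorem highestWeight_nonneg {X : Type*} [AddCommGroup X] [Module ℂ X]
    {ρ : Representation ℂ Sp1 X} {r : ℤ} (hρ : HasHighestWeight ρ r) : 0 ≤ r := by
  obtain ⟨⟨w, h0, h⟩, hmax⟩ := hρ
  have : -r ≤ r := by
    refine hmax _ ⟨ρ unitJ w, fun hw => h0 ?_, fun θ => ?_⟩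
    · have := congrArg (ρ unitJ⁻¹) hw
      rwa [← Module.End.mul_apply, ← map_mul, inv_mul_cancel, map_one, map_zero] at this
    · rw [← Module.End.mul_apply, ← map_mul, expI_mul_unitJ, map_mul, Module.End.mul_apply, h,
        map_smul]
      congr 2
      push_cast
      ring
  omega

theorem isotypic_eq_bot {X : Type*} [AddCommGroup X] [Module ℂ X]
    {ρ : Representation ℂ Sp1 X} {r : ℤ} (hr : r < 0) : isotypic ρ r = ⊥ :=
  eq_bot_iff.2 <| iSup_le fun _ => iSup_le fun _ => iSup_le fun h =>
    absurd (highestWeight_nonneg h) (by omega)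

theorem isotypic_apply_mem {X : Type*} [AddCommGroup X] [Module ℂ X]
    (ρ : Representation ℂ Sp1 X) (r : ℤ) (q : Sp1) :
    isotypic ρ r ≤ (isotypic ρ r).comap (ρ q) :=
  iSup_le fun W => iSup_le fun h => iSup_le fun h' _ hw =>
    Submodule.mem_iSup_of_mem W (Submodule.mem_iSup_of_mem h
      (Submodule.mem_iSup_of_mem h' (W.apply_mem_toSubmodule q hw)))

/-- Irreducibility is expressed through submodules of the ambient space, which avoids
subrepresentations of subrepresentations. -/
theorem isIrreducible_iff {X : Type*} [AddCommGroup X] [Module ℂ X]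
    {ρ : Representation ℂ Sp1 X} (W : Subrepresentation ρ) :
    Representation.IsIrreducible (k := ℂ) (V := W.toSubmodule) W.toRepresentation ↔
      W.toSubmodule ≠ ⊥ ∧ ∀ P : Subrepresentation ρ, P.toSubmodule ≤ W.toSubmodule →
        P.toSubmodule = ⊥ ∨ P.toSubmodule = W.toSubmodule := by
  constructor
  · intro h
    refine ⟨fun h0 => ?_, fun P hP => ?_⟩
    · obtain ⟨A, B, hAB⟩ := h.exists_pair_ne
      have : Subsingleton W.toSubmodule := (Submodule.subsingleton_iff_eq_bot).2 h0
      exact hAB (Subrepresentation.toSubmodule_injective (Subsingleton.elim _ _))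
    · let P' : Subrepresentation W.toRepresentation :=
        ⟨P.toSubmodule.comap W.toSubmodule.subtype, fun q v hv => P.apply_mem_toSubmodule q hv⟩
      rcases h.eq_bot_or_eq_top P' with h' | h'
      · left
        refine eq_bot_iff.2 fun x hx => ?_
        have hx' : (⟨x, hP hx⟩ : W.toSubmodule) ∈ P'.toSubmodule := hx
        rw [h'] at hx'
        exact congrArg Subtype.val ((Submodule.mem_bot ℂ).1 hx')
      · right
        refine hP.antisymm fun x hx => ?_
        have hx' : (⟨x, hx⟩ : W.toSubmodule) ∈ P'.toSubmodule := by rw [h']; trivial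
        exact hx'
  · rintro ⟨h0, h⟩
    refine { exists_pair_ne := ⟨⊥, ⊤, fun hbt => h0 ?_⟩, eq_bot_or_eq_top := fun P => ?_ }
    · have h' : (⊥ : Submodule ℂ W.toSubmodule) = ⊤ :=
        congrArg Subrepresentation.toSubmodule hbt
      refine eq_bot_iff.2 fun x hx => ?_
      have : (⟨x, hx⟩ : W.toSubmodule) ∈ (⊥ : Submodule ℂ W.toSubmodule) :=
        h' ▸ Submodule.mem_top
      simpa using this
    · have hinj := Submodule.map_injective_of_injective W.toSubmodule.injective_subtype
      rcases h ⟨P.toSubmodule.map W.toSubmodule.subtype, by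
          rintro q _ ⟨x, hx, rfl⟩
          exact ⟨_, P.apply_mem_toSubmodule q hx, rfl⟩⟩ (Submodule.map_subtype_le _ _) with h' | h'
      · exact Or.inl (Subrepresentation.toSubmodule_injective
          (hinj (h'.trans (Submodule.map_bot _).symm)))
      · exact Or.inr (Subrepresentation.toSubmodule_injective
          (hinj (h'.trans (Submodule.map_subtype_top _).symm)))

/-- An equivalence of representations maps isotypic components to isotypic components. -/
theorem isotypic_le_comap {X Y : Type*} [AddCommGroup X] [Module ℂ X] [AddCommGroup Y]
    [Module ℂ Y] {ρ : Representation ℂ Sp1 X} {σ : Representation ℂ Sp1 Y} (e : X ≃ₗ[ℂ] Y)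
    (he : ∀ q x, e (ρ q x) = σ q (e x)) (r : ℤ) :
    isotypic ρ r ≤ (isotypic σ r).comap (e : X →ₗ[ℂ] Y) := by
  refine iSup_le fun W => iSup_le fun hirr => iSup_le fun hr x hx => ?_
  let W' : Subrepresentation σ := ⟨W.toSubmodule.map (e : X →ₗ[ℂ] Y), by
    rintro q _ ⟨x, hx, rfl⟩
    exact ⟨ρ q x, W.apply_mem_toSubmodule q hx, he q x⟩⟩
  have hweight (m : ℤ) : HasWeight W'.toRepresentation m ↔ HasWeight W.toRepresentation m := by
    constructor
    · rintro ⟨⟨_, w, hw, rfl⟩, h0, h⟩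
      refine ⟨⟨w, hw⟩, fun hw0 => h0 (Subtype.ext ?_), fun θ => Subtype.ext ?_⟩
      · have : w = 0 := congrArg Subtype.val hw0
        simp [this]
      · have h1 : σ (expI θ) (e w) = Complex.exp (Complex.I * m * θ) • e w :=
          congrArg Subtype.val (h θ)
        rw [← he, ← map_smul] at h1
        exact e.injective h1
    · rintro ⟨⟨w, hw⟩, h0, h⟩
      refine ⟨⟨e w, w, hw, rfl⟩, fun hw0 => h0 (Subtype.ext ?_), fun θ => Subtype.ext ?_⟩
      · have : e w = 0 := congrArg Subtype.val hw0
        simpa using this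
      · have h1 : ρ (expI θ) w = Complex.exp (Complex.I * m * θ) • w := congrArg Subtype.val (h θ)
        change σ (expI θ) (e w) = Complex.exp (Complex.I * m * θ) • e w
        rw [← he, h1, map_smul]
  have hr' : HasHighestWeight W'.toRepresentation r :=
    ⟨(hweight r).2 hr.1, fun m hm => hr.2 m ((hweight m).1 hm)⟩
  have hirr' : Representation.IsIrreducible (k := ℂ) (V := W'.toSubmodule) W'.toRepresentation := by
    rw [isIrreducible_iff] at hirr ⊢
    have hinj := Submodule.map_injective_of_injective (f := (e : X →ₗ[ℂ] Y)) e.injective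
    have hbot : (⊥ : Submodule ℂ X).map (e : X →ₗ[ℂ] Y) = ⊥ := Submodule.map_bot _
    refine ⟨fun h => hirr.1 (hinj (h.trans hbot.symm)), fun P hP => ?_⟩
    have hmap : (P.toSubmodule.comap (e : X →ₗ[ℂ] Y)).map (e : X →ₗ[ℂ] Y) = P.toSubmodule :=
      Submodule.map_comap_eq_of_surjective e.surjective _
    rcases hirr.2 ⟨P.toSubmodule.comap (e : X →ₗ[ℂ] Y), fun q v hv => by
      change e (ρ q v) ∈ P.toSubmodule
      rw [he]
      exact P.apply_mem_toSubmodule q hv⟩ (by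
        intro v hv
        obtain ⟨w, hw, hwv⟩ := hP hv
        rwa [← e.injective hwv]) with h | h
    · exact Or.inl (hmap.symm.trans ((congrArg _ h).trans hbot))
    · exact Or.inr (hmap.symm.trans (congrArg _ h))
  exact Submodule.mem_iSup_of_mem W' (Submodule.mem_iSup_of_mem hirr'
    (Submodule.mem_iSup_of_mem hr' ⟨x, hx, rfl⟩))

/-- A nonzero finite-dimensional representation contains an irreducible one. -/
theorem exists_irreducible_le {X : Type*} [AddCommGroup X] [Module ℂ X] [FiniteDimensional ℂ X]
    {ρ : Representation ℂ Sp1 X} (W : Subrepresentation ρ) (hW : W.toSubmodule ≠ ⊥) :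
    ∃ U : Subrepresentation ρ, U.toSubmodule ≤ W.toSubmodule ∧ U.toSubmodule ≠ ⊥ ∧
      Representation.IsIrreducible (k := ℂ) (V := U.toSubmodule) U.toRepresentation := by
  let S : Set (Submodule ℂ X) :=
    {U | U ≠ ⊥ ∧ U ≤ W.toSubmodule ∧ ∀ q, ∀ x ∈ U, ρ q x ∈ U}
  -- A minimal nonzero invariant subspace is irreducible; finite dimension provides one.
  obtain ⟨U, ⟨hU0, hUW, hUρ⟩, hmin⟩ := wellFounded_lt.has_min S
    ⟨W.toSubmodule, hW, le_rfl, fun q x hx => W.apply_mem_toSubmodule q hx⟩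
  refine ⟨⟨U, fun q x hx => hUρ q x hx⟩, hUW, hU0, (isIrreducible_iff _).2 ⟨hU0, fun P hP => ?_⟩⟩
  by_cases h0 : P.toSubmodule = ⊥
  · exact Or.inl h0
  · exact Or.inr (hP.antisymm (not_lt_iff_le_imp_ge.1 (hmin _ ⟨h0, hP.trans hUW,
      fun q x hx => P.apply_mem_toSubmodule q hx⟩) hP))

/-! ### Weights, the Casimir eigenvalue and complete reducibility -/

namespace InfAction

variable (L : InfAction ρ)

/-- The Casimir operator. -/
def C : X →ₗ[ℂ] X := -(L.I ∘ₗ L.I + L.J ∘ₗ L.J + L.K ∘ₗ L.K)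

theorem C_apply (x : X) : L.C x = -(L.I (L.I x) + L.J (L.J x) + L.K (L.K x)) := rfl

theorem C_comm (q : Sp1) (x : X) : L.C (ρ q x) = ρ q (L.C x) := by
  rw [C, LinearMap.neg_apply, L.casimir_comm, LinearMap.neg_apply, map_neg]

section

variable [IsScalarTower ℝ ℂ X] [FiniteDimensional ℂ X]

/-- Difference quotients stay in `W`, which is closed because it is finite-dimensional. -/
theorem mem_of_hasDerivAt (W : Submodule ℂ X) {f : ℝ → X} {f' : X} {t : ℝ}
    (hf : HasDerivAt f f' t) (hW : ∀ s, f s ∈ W) : f' ∈ W := by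
  rw [hasDerivAt_iff_tendsto_slope] at hf
  refine W.closed_of_finiteDimensional.mem_of_tendsto hf (Filter.Eventually.of_forall fun s => ?_)
  rw [slope_def_module]
  exact (W.restrictScalars ℝ).smul_mem _ (W.sub_mem (hW _) (hW _))

variable (W : Subrepresentation ρ)

theorem I_mem {w : X} (hw : w ∈ W.toSubmodule) : L.I w ∈ W.toSubmodule := by
  have h := L.hasDerivAt_I w 0
  rw [expI_zero, map_one] at h
  exact mem_of_hasDerivAt _ h fun s => W.apply_mem_toSubmodule _ hw

theorem J_mem {w : X} (hw : w ∈ W.toSubmodule) : L.J w ∈ W.toSubmodule := by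
  obtain ⟨c, hc⟩ := L.exists_J
  exact mem_of_hasDerivAt _ (hc w) fun s => W.apply_mem_toSubmodule _ hw

theorem K_mem {w : X} (hw : w ∈ W.toSubmodule) : L.K w ∈ W.toSubmodule := by
  obtain ⟨c, hc⟩ := L.exists_K
  exact mem_of_hasDerivAt _ (hc w) fun s => W.apply_mem_toSubmodule _ hw

end

section

variable [IsScalarTower ℝ ℂ X]

/-- An eigenvector of the infinitesimal action of `i` is an eigenvector of `U(1)`. -/
theorem expI_apply_of_I_eq {w : X} {c : ℂ} (hw : L.I w = c • w) (θ : ℝ) :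
    ρ (expI θ) w = Complex.exp (c * θ) • w := by
  -- Uniqueness for the linear differential equation: multiplication by the inverse exponential
  -- gives a constant curve.
  have h (t : ℝ) : HasDerivAt (fun t : ℝ => Complex.exp (-(c * t)) • ρ (expI t) w) 0 t := by
    have h1 := L.hasDerivAt_I w t
    have h2 : HasDerivAt (fun t : ℝ => Complex.exp (-(c * t)))
        (Complex.exp (-(c * t)) * (-c)) t := by
      have h3 : HasDerivAt (fun z : ℂ => Complex.exp (-(c * z)))
          (Complex.exp (-(c * t)) * (-(c * 1))) (t : ℂ) :=
        ((hasDerivAt_id (t : ℂ)).const_mul c).neg.cexp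
      simpa using h3.comp_ofReal
    have h4 := h2.smul h1
    rw [hw, map_smul] at h4
    have h5 : (0 : X) = Complex.exp (-(c * t)) • c • ρ (expI t) w +
        (Complex.exp (-(c * t)) * -c) • ρ (expI t) w := by module
    rw [h5]
    exact h4
  have h0 := is_const_of_deriv_eq_zero (fun t => (h t).differentiableAt) (fun t => (h t).deriv) θ 0
  simp only [Complex.ofReal_zero, mul_zero, neg_zero, Complex.exp_zero, expI_zero, map_one,
    one_smul, Module.End.one_apply] at h0
  conv_rhs => rw [← h0]
  rw [smul_smul, ← Complex.exp_add]
  simp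

theorem I_eq_of_expI_apply {w : X} {c : ℂ}
    (hw : ∀ θ : ℝ, ρ (expI θ) w = Complex.exp (c * θ) • w) : L.I w = c • w := by
  have h := L.hasDerivAt_I w 0
  rw [expI_zero, map_one] at h
  have h2 : HasDerivAt (fun t : ℝ => Complex.exp (c * t)) (c) 0 := by
    have h3 : HasDerivAt (fun z : ℂ => Complex.exp (c * z))
        (Complex.exp (c * (0 : ℝ)) * (c * 1)) ((0 : ℝ) : ℂ) :=
      ((hasDerivAt_id ((0 : ℝ) : ℂ)).const_mul c).cexp
    simpa using h3.comp_ofReal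
  have h4 := h2.smul_const w
  simp only [hw] at h
  exact h.unique h4

theorem hasWeight_iff (W : Subrepresentation ρ) (m : ℤ) : HasWeight W.toRepresentation m ↔
    ∃ w ∈ W.toSubmodule, w ≠ 0 ∧ L.I w = (Complex.I * m) • w := by
  constructor
  · rintro ⟨w, hw, h⟩
    refine ⟨w, w.2, by simpa using hw, L.I_eq_of_expI_apply fun θ => ?_⟩
    exact congrArg Subtype.val (h θ)
  · rintro ⟨w, hw, h0, h⟩
    refine ⟨⟨w, hw⟩, by simpa using h0, fun θ => Subtype.ext ?_⟩
    exact L.expI_apply_of_I_eq h θ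

/-- The one-parameter group closes up at `2π`, so `exp(2πc) = 1`. -/
theorem exists_int_of_I_eq {w : X} (hw0 : w ≠ 0) {c : ℂ} (hw : L.I w = c • w) :
    ∃ m : ℤ, c = Complex.I * m := by
  have h := L.expI_apply_of_I_eq hw (2 * Real.pi)
  rw [expI_two_pi, map_one, Module.End.one_apply] at h
  have h1 : Complex.exp (c * (2 * Real.pi : ℝ)) = 1 := by
    have : (1 - Complex.exp (c * (2 * Real.pi : ℝ))) • w = 0 := by
      rw [sub_smul, one_smul, ← h, sub_self]
    exact (sub_eq_zero.1 ((smul_eq_zero.1 this).resolve_right hw0)).symm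
  obtain ⟨m, hm⟩ := Complex.exp_eq_one_iff.1 h1
  refine ⟨m, ?_⟩
  have hpi : (Real.pi : ℂ) ≠ 0 := by exact_mod_cast Real.pi_ne_zero
  push_cast at hm
  have : (c - Complex.I * m) * (2 * Real.pi) = 0 := by linear_combination hm
  simpa [hpi, sub_eq_zero] using this

/-- The eigenspaces of the Casimir operator are subrepresentations. -/
def eigenSubrep (c : ℂ) : Subrepresentation ρ where
  toSubmodule := Module.End.eigenspace L.C c
  apply_mem_toSubmodule q w hw := by
    rw [Module.End.mem_eigenspace_iff] at hw ⊢
    rw [C_comm, hw, map_smul]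

variable [FiniteDimensional ℂ X]

theorem exists_hasWeight (L : InfAction ρ) (W : Subrepresentation ρ) (hW : W.toSubmodule ≠ ⊥) :
    ∃ m, HasWeight W.toRepresentation m := by
  have : Nontrivial W.toSubmodule := (Submodule.nontrivial_iff_ne_bot).2 hW
  obtain ⟨c, hc⟩ := Module.End.exists_eigenvalue
    (L.I.restrict fun w hw => L.I_mem W hw : W.toSubmodule →ₗ[ℂ] W.toSubmodule)
  obtain ⟨w, hw⟩ := hc.exists_hasEigenvector
  have h1 : L.I w = c • (w : X) := congrArg Subtype.val hw.apply_eq_smul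
  have h0 : (w : X) ≠ 0 := by simpa using hw.2
  obtain ⟨m, rfl⟩ := L.exists_int_of_I_eq h0 h1
  exact ⟨m, (L.hasWeight_iff W m).2 ⟨w, w.2, h0, h1⟩⟩

theorem exists_hasHighestWeight (L : InfAction ρ) (W : Subrepresentation ρ)
    (hW : W.toSubmodule ≠ ⊥) :
    ∃ r, HasHighestWeight W.toRepresentation r := by
  have hfin : {m : ℤ | HasWeight W.toRepresentation m}.Finite := by
    refine Set.Finite.of_finite_image (f := fun m : ℤ => Complex.I * m)
      ((Module.End.finite_hasEigenvalue L.I).subset ?_) fun a _ b _ hab => ?_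
    · rintro _ ⟨m, hm, rfl⟩
      obtain ⟨w, -, h0, h⟩ := (L.hasWeight_iff W m).1 hm
      exact Module.End.hasEigenvalue_of_hasEigenvector ⟨Module.End.mem_eigenspace_iff.2 h, h0⟩
    · simpa using hab
  obtain ⟨r, hr, hmax⟩ := hfin.exists_maximalFor id _ (L.exists_hasWeight W hW)
  exact ⟨r, hr, fun m hm => (le_total m r).elim id fun h => hmax hm h⟩

/-- The Casimir operator on a highest weight vector. -/
theorem C_of_highestWeight (W : Subrepresentation ρ) {r : ℤ}
    (hW : HasHighestWeight W.toRepresentation r) :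
    ∃ w ∈ W.toSubmodule, w ≠ 0 ∧ L.C w = (r * (r + 2) : ℂ) • w := by
  obtain ⟨w, hw, h0, h⟩ := (L.hasWeight_iff W r).1 hW.1
  refine ⟨w, hw, h0, ?_⟩
  have hII : Complex.I * Complex.I = -1 := Complex.I_mul_I
  -- `J - iK` is the raising operator. If its value on `w` were nonzero, it would have weight `r +
  -- 2`, against maximality.
  have he : L.J w - Complex.I • L.K w = 0 := by
    by_contra hne
    have := hW.2 (r + 2) ((L.hasWeight_iff W _).2 ⟨_, W.toSubmodule.sub_mem (L.J_mem W hw)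
      (W.toSubmodule.smul_mem _ (L.K_mem W hw)), hne, ?_⟩)
    · omega
    · have h3 : L.I (L.K w) = (Complex.I * r) • L.K w - (2 : ℂ) • L.J w := by
        rw [eq_sub_iff_add_eq, ← L.comm_KI, h, map_smul]
      rw [map_sub, map_smul, L.comm_IJ, h, map_smul, h3]
      push_cast
      match_scalars
      · ring
      · linear_combination (2 : ℂ) * hII
  have hJ : L.J w = Complex.I • L.K w := sub_eq_zero.1 he
  have hK : L.K w = -Complex.I • L.J w := by
    rw [hJ, smul_smul]; simp
  have hJJ : L.J (L.J w) = Complex.I • L.J (L.K w) := by rw [← map_smul, ← hJ]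
  have hKK : L.K (L.K w) = -Complex.I • L.K (L.J w) := by rw [← map_smul, ← hK]
  -- With `J w = i K w`, the sum `J² w + K² w` becomes `i[J, K] w = 2i I w = -2r w`; together with
  -- `I² w = -r² w` this gives `r(r+2)`.
  rw [C_apply, hJJ, hKK, L.comm_JK, h, map_smul, h]
  match_scalars
  · linear_combination (-(r : ℂ) ^ 2 - 2 * r) * hII
  · ring

/-- A form of Schur's lemma: the Casimir eigenspace is a subrepresentation and meets `W` in the
highest weight vector, so it contains `W`. -/
theorem casimir_eq_of_irreducible (W : Subrepresentation ρ)
    (hirr : Representation.IsIrreducible (k := ℂ) (V := W.toSubmodule) W.toRepresentation) {r : ℤ}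
    (hW : HasHighestWeight W.toRepresentation r) :
    W.toSubmodule ≤ Module.End.eigenspace L.C (r * (r + 2) : ℂ) := by
  obtain ⟨w, hw, h0, h⟩ := L.C_of_highestWeight W hW
  let U := W ⊓ L.eigenSubrep (r * (r + 2) : ℂ)
  have hU : U.toSubmodule = W.toSubmodule := by
    refine (((isIrreducible_iff W).1 hirr).2 U inf_le_left).resolve_left fun hbot => h0 ?_
    have : w ∈ U.toSubmodule := ⟨hw, Module.End.mem_eigenspace_iff.2 h⟩
    rwa [hbot, Submodule.mem_bot] at this
  rw [← hU]
  exact inf_le_right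

theorem isotypic_le (r : ℤ) : isotypic ρ r ≤ Module.End.eigenspace L.C (r * (r + 2) : ℂ) :=
  iSup_le fun W => iSup_le fun h => iSup_le fun h' => L.casimir_eq_of_irreducible W h h'

/-- Take an invariant complement of the sum on the right. If it met the eigenspace, the intersection
would contain an irreducible representation, whose highest weight `r` satisfies `c = r(r+2)`; that
representation already lies in the sum. -/
theorem eigenspace_le (c : ℂ) : Module.End.eigenspace L.C c ≤
    ⨆ (r : ℤ) (_ : 0 ≤ r ∧ c = r * (r + 2)), isotypic ρ r := by
  set S := ⨆ (r : ℤ) (_ : 0 ≤ r ∧ c = r * (r + 2)), isotypic ρ r with hS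
  have hSle (r : ℤ) (hr : 0 ≤ r ∧ c = r * (r + 2)) : isotypic ρ r ≤ S :=
    le_iSup₂_of_le r hr le_rfl
  let S' : Subrepresentation ρ := ⟨S, fun q => by
    change S ≤ S.comap (ρ q)
    exact iSup₂_le fun r hr => (isotypic_apply_mem ρ r q).trans (Submodule.comap_mono (hSle r hr))⟩
  have hSN : S ≤ Module.End.eigenspace L.C c := iSup₂_le fun r hr => by
    rw [hr.2]
    exact L.isotypic_le r
  obtain ⟨U', hU'⟩ := L.exists_isCompl S'
  have hbot : (U' ⊓ L.eigenSubrep c).toSubmodule = ⊥ := by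
    by_contra hne
    obtain ⟨U, hU, hU0, hirr⟩ := exists_irreducible_le _ hne
    obtain ⟨r, hr⟩ := L.exists_hasHighestWeight U hU0
    obtain ⟨w, hw, h0, h⟩ := L.C_of_highestWeight U hr
    have hc : L.C w = c • w := Module.End.mem_eigenspace_iff.1 (hU hw).2
    have hcr : c = r * (r + 2) := by
      have : (c - r * (r + 2)) • w = 0 := by rw [sub_smul, ← hc, ← h, sub_self]
      exact sub_eq_zero.1 ((smul_eq_zero.1 this).resolve_right h0)
    have hUS : U.toSubmodule ≤ S :=
      le_trans (fun x hx => Submodule.mem_iSup_of_mem U (Submodule.mem_iSup_of_mem hirr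
        (Submodule.mem_iSup_of_mem hr hx))) (hSle r ⟨highestWeight_nonneg hr, hcr⟩)
    exact h0 ((Submodule.mem_bot ℂ).1 (hU'.disjoint.le_bot ⟨hUS hw, (hU hw).1⟩))
  intro x hx
  obtain ⟨u, hu, z, hz, rfl⟩ :=
    Submodule.mem_sup.1 (hU'.codisjoint.eq_top ▸ Submodule.mem_top :
      x ∈ S'.toSubmodule ⊔ U'.toSubmodule)
  have hzN : z ∈ Module.End.eigenspace L.C c := by
    simpa using Submodule.sub_mem _ hx (hSN hu)
  have hz0 : z ∈ (U' ⊓ L.eigenSubrep c).toSubmodule := ⟨hz, hzN⟩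
  rw [hbot, Submodule.mem_bot] at hz0
  rw [hz0, add_zero]
  exact hu

/-- The isotypic components are the eigenspaces of the Casimir operator. -/
theorem isotypic_eq {r : ℤ} (hr : -1 ≤ r) :
    isotypic ρ r = Module.End.eigenspace L.C (r * (r + 2) : ℂ) := by
  refine le_antisymm (L.isotypic_le r) ((L.eigenspace_le _).trans (iSup₂_le fun s hs => ?_))
  have h : r * (r + 2) = s * (s + 2) := by exact_mod_cast hs.2
  -- The eigenvalue determines the weight up to `s ↦ -2 - s`. The bounds `r ≥ -1` and `s ≥ 0`
  -- exclude the reflected solution; `r = -1` is kept because lowering weight `0` leads there.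
  have : (r - s) * (r + s + 2) = 0 := by linear_combination h
  rcases mul_eq_zero.1 this with h | h
  · rw [sub_eq_zero.1 h]
  · omega

end
end InfAction

end Isotypic

/-! ### An invariant inner product on forms -/

section Inner

variable {V : Type*} [NormedAddCommGroup V] [NormedSpace ℝ V] {ι : Type*} {k : ℕ}

/-- The values of a form on the tuples of basis vectors. -/
def basisValues (b : Module.Basis ι ℝ V) (k : ℕ) :
    (V [⋀^Fin k]→L[ℝ] ℂ) →ₗ[ℂ] EuclideanSpace ℂ (Fin k → ι) where
  toFun α := WithLp.toLp 2 fun f => α fun l => b (f l)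
  map_add' α β := by ext f; simp
  map_smul' c α := by ext f; simp

theorem basisValues_apply (b : Module.Basis ι ℝ V) (α : V [⋀^Fin k]→L[ℝ] ℂ) (f : Fin k → ι) :
    basisValues b k α f = α fun l => b (f l) := rfl

theorem basisValues_injective (b : Module.Basis ι ℝ V) (k : ℕ) :
    Function.Injective (basisValues b k) := by
  intro α β h
  apply ContinuousAlternatingMap.toAlternatingMap_injective
  refine Module.Basis.ext_alternating b fun f _ => ?_
  exact congrFun (congrArg WithLp.ofLp h) f

/-- If the matrix of `g` is orthogonal, so is its `k`-th tensor power, which describes the effect of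
pullback on the values at all `k`-tuples of basis vectors. -/
theorem inner_basisValues_comp [Fintype ι] [DecidableEq ι] (b : Module.Basis ι ℝ V) {g : V →L[ℝ] V}
    (hg : ∀ j j', ∑ i, b.repr (g (b i)) j * b.repr (g (b i)) j' = if j = j' then 1 else 0)
    (α β : V [⋀^Fin k]→L[ℝ] ℂ) :
    inner ℂ (basisValues b k (α.compContinuousLinearMap g))
      (basisValues b k (β.compContinuousLinearMap g)) =
    inner ℂ (basisValues b k α) (basisValues b k β) := by
  have key (α : V [⋀^Fin k]→L[ℝ] ℂ) (f : Fin k → ι) :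
      basisValues b k (α.compContinuousLinearMap g) f =
        ∑ h : Fin k → ι, ((∏ l, b.repr (g (b (f l))) (h l) : ℝ) : ℂ) * basisValues b k α h := by
    simp only [basisValues_apply, ContinuousAlternatingMap.compContinuousLinearMap_apply]
    have : (g ∘ fun l => b (f l)) = fun l => ∑ j, b.repr (g (b (f l))) j • b j := by
      funext l
      exact (b.sum_repr _).symm
    rw [this, ContinuousAlternatingMap.map_sum]
    refine Finset.sum_congr rfl fun h _ => ?_
    rw [ContinuousAlternatingMap.map_smul_univ, Complex.real_smul]
  -- A sum over `k`-tuples of a product over slots is the product of the slotwise sums, each given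
  -- by orthogonality of `g`.
  have orth (h h' : Fin k → ι) : (∑ f : Fin k → ι, (∏ l, b.repr (g (b (f l))) (h l)) *
      ∏ l, b.repr (g (b (f l))) (h' l)) = if h = h' then 1 else 0 := by
    simp only [← Finset.prod_mul_distrib]
    rw [← Fintype.piFinset_univ, ← Finset.prod_univ_sum
      (fun _ => Finset.univ) (fun l i => b.repr (g (b i)) (h l) * b.repr (g (b i)) (h' l))]
    simp only [hg]
    by_cases hh : h = h'
    · simp [hh]
    · obtain ⟨l, hl⟩ := Function.ne_iff.1 hh
      rw [if_neg hh]
      exact Finset.prod_eq_zero (Finset.mem_univ l) (if_neg hl)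
  simp only [PiLp.inner_apply, RCLike.inner_apply, key, map_sum, map_mul, Complex.conj_ofReal]
  simp only [Finset.sum_mul_sum]
  rw [Finset.sum_comm]
  refine Finset.sum_congr rfl fun h _ => ?_
  rw [Finset.sum_comm, Finset.sum_eq_single h]
  · rw [← one_mul (_ * _), ← Complex.ofReal_one, ← if_pos (rfl : h = h) (t := (1 : ℝ)) (e := 0),
      ← orth h h]
    push_cast
    rw [Finset.sum_mul]
    exact Finset.sum_congr rfl fun f _ => by ring
  · intro h' _ hne
    have := orth h h'
    rw [if_neg hne.symm] at this
    have h2 := congrArg (Complex.ofReal) this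
    push_cast at h2
    calc _ = (∑ f : Fin k → ι, (∏ l, ((b.repr (g (b (f l))) (h l) : ℝ) : ℂ)) *
          ∏ l, ((b.repr (g (b (f l))) (h' l) : ℝ) : ℂ)) *
          (basisValues b k β h * (starRingEnd ℂ) (basisValues b k α h')) := by
            rw [Finset.sum_mul]
            push_cast
            exact Finset.sum_congr rfl fun f _ => by ring
      _ = 0 := by rw [h2, zero_mul]
  · simp

end Inner

/-! ### The representation of `Sp(1)` on the forms on `ℍⁿ` -/

section QuaternionicForms

variable {n k : ℕ}

/-- The standard real basis of `ℍ`. -/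
def hBasis : Module.Basis (Fin 4) ℝ ℍ[ℝ] := QuaternionAlgebra.basisOneIJK (-1 : ℝ) 0 (-1)

theorem hBasis_repr (z : ℍ[ℝ]) : (hBasis.repr z : Fin 4 → ℝ) = ![z.re, z.imI, z.imJ, z.imK] := rfl

theorem hBasis_apply (a : Fin 4) : hBasis a = ![1, qI, qJ, qK] a := by
  have h (z : ℍ[ℝ]) (hz : ![z.re, z.imI, z.imJ, z.imK] = (Pi.single a 1 : Fin 4 → ℝ)) :
      hBasis a = z := by
    apply hBasis.repr.injective
    rw [Module.Basis.repr_self]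
    apply DFunLike.coe_injective
    rw [hBasis_repr, hz, Finsupp.single_eq_pi_single]
  apply h
  fin_cases a <;> ext b <;> fin_cases b <;> simp

/-- The standard real basis of `ℍⁿ`. -/
def quatBasis (n : ℕ) : Module.Basis ((_ : Fin n) × Fin 4) ℝ (Fin n → ℍ[ℝ]) :=
  Pi.basis fun _ => hBasis

theorem quatBasis_repr_leftMul (q : ℍ[ℝ]) (i j : (_ : Fin n) × Fin 4) :
    (quatBasis n).repr (leftMul n q (quatBasis n i)) j =
      if i.1 = j.1 then hBasis.repr (q * hBasis i.2) j.2 else 0 := by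
  obtain ⟨i, a⟩ := i
  obtain ⟨j, c⟩ := j
  rw [quatBasis, Pi.basis_repr, Pi.basis_apply, leftMul_apply]
  split_ifs with h
  · obtain rfl : i = j := h
    rw [Pi.single_eq_same]
  · rw [Pi.single_eq_of_ne (Ne.symm h), mul_zero, map_zero]
    rfl

theorem sq_sum_eq_one_of_mem_unitary {q : ℍ[ℝ]} (hq : q ∈ unitary ℍ[ℝ]) :
    q.re ^ 2 + q.imI ^ 2 + q.imJ ^ 2 + q.imK ^ 2 = 1 := by
  have := congrArg (fun z : ℍ[ℝ] => z.re) (Unitary.star_mul_self_of_mem hq)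
  simp at this
  nlinarith

theorem sum_hBasis_repr_mul {q : ℍ[ℝ]} (hq : q ∈ unitary ℍ[ℝ]) (c d : Fin 4) :
    ∑ a, hBasis.repr (q * hBasis a) c * hBasis.repr (q * hBasis a) d = if c = d then 1 else 0 := by
  have hq1 := sq_sum_eq_one_of_mem_unitary hq
  simp only [Fin.sum_univ_four, hBasis_apply, hBasis_repr]
  fin_cases c <;> fin_cases d <;> simp <;> first | ring1 | linear_combination hq1

theorem quatBasis_orthogonal {q : ℍ[ℝ]} (hq : q ∈ unitary ℍ[ℝ]) (j j' : (_ : Fin n) × Fin 4) :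
    ∑ i, (quatBasis n).repr (leftMul n q (quatBasis n i)) j *
      (quatBasis n).repr (leftMul n q (quatBasis n i)) j' = if j = j' then 1 else 0 := by
  obtain ⟨m, c⟩ := j
  obtain ⟨m', d⟩ := j'
  simp only [quatBasis_repr_leftMul]
  rw [Fintype.sum_sigma, Finset.sum_eq_single m]
  · by_cases h : m = m'
    · subst h
      simp only [if_true]
      rw [sum_hBasis_repr_mul hq]
      simp
    · simp [h]
  · intro i _ hi
    simp [hi]
  · simp

instance : FiniteDimensional ℂ (QForm n k) :=
  FiniteDimensional.of_injective _ (basisValues_injective (quatBasis n) k)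

/-- The representation of `Sp(1)` on the forms on `ℍⁿ`. -/
def stdRep (n k : ℕ) : Representation ℂ Sp1 (QForm n k) :=
  formRep (ContinuousLinearEquiv.refl ℝ (Fin n → ℍ[ℝ])) k

theorem stdRep_apply (q : Sp1) (α : QForm n k) :
    stdRep n k q α = α.compContinuousLinearMap (leftMul n (star (q : ℍ[ℝ]))) := rfl

theorem inner_stdRep (q : Sp1) (α β : QForm n k) :
    inner ℂ (basisValues (quatBasis n) k (stdRep n k q α))
      (basisValues (quatBasis n) k (stdRep n k q β)) =
    inner ℂ (basisValues (quatBasis n) k α) (basisValues (quatBasis n) k β) :=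
  inner_basisValues_comp _ (quatBasis_orthogonal (Unitary.star_mem q.2)) α β

/-- The complement is orthogonal for the invariant inner product transported through the values on
basis tuples. -/
theorem stdRep_exists_isCompl (U : Subrepresentation (stdRep n k)) :
    ∃ U' : Subrepresentation (stdRep n k), IsCompl U.toSubmodule U'.toSubmodule := by
  set Φ := basisValues (quatBasis n) k
  refine ⟨⟨((U.toSubmodule.map Φ)ᗮ).comap Φ, fun q α hα => ?_⟩, ?_, ?_⟩
  · rw [Submodule.mem_comap, Submodule.mem_orthogonal]
    rintro _ ⟨β, hβ, rfl⟩
    have h := inner_stdRep q (stdRep n k q⁻¹ β) α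
    rw [← Module.End.mul_apply, ← map_mul, mul_inv_cancel, map_one, Module.End.one_apply] at h
    rw [h]
    exact (Submodule.mem_orthogonal _ _).1 hα _ ⟨_, U.apply_mem_toSubmodule q⁻¹ hβ, rfl⟩
  · rw [Submodule.disjoint_def]
    intro α hα hα'
    have h := (Submodule.mem_orthogonal _ _).1 hα' _ ⟨α, hα, rfl⟩
    exact basisValues_injective (quatBasis n) k ((inner_self_eq_zero.1 h).trans (map_zero Φ).symm)
  · rw [codisjoint_iff, eq_top_iff]
    intro α _
    obtain ⟨y, hy, z, hz, h⟩ :=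
      (U.toSubmodule.map Φ).exists_add_mem_mem_orthogonal (Φ α)
    obtain ⟨β, hβ, rfl⟩ := hy
    refine Submodule.mem_sup.2 ⟨β, hβ, α - β, ?_, by abel⟩
    rw [Submodule.mem_comap, map_sub, h, add_sub_cancel_left]
    exact hz

theorem fderivCompContinuousLinearMap_comp {V : Type*} [NormedAddCommGroup V] [NormedSpace ℝ V]
    (α : V [⋀^Fin k]→L[ℝ] ℂ) (A g : V →L[ℝ] V) :
    α.fderivCompContinuousLinearMap g (A ∘L g) = -(lieDer A α).compContinuousLinearMap g := by
  ext v
  simp only [ContinuousAlternatingMap.fderivCompContinuousLinearMap_apply,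
    ContinuousAlternatingMap.neg_apply, ContinuousAlternatingMap.compContinuousLinearMap_apply,
    lieDer_apply, neg_neg]
  refine Finset.sum_congr rfl fun i _ => congrArg α (funext fun j => ?_)
  rcases eq_or_ne j i with rfl | h <;> simp [*]

theorem hasDerivAt_compContinuousLinearMap {V : Type*} [NormedAddCommGroup V] [NormedSpace ℝ V]
    (α : V [⋀^Fin k]→L[ℝ] ℂ) {g : ℝ → V →L[ℝ] V} {g' : V →L[ℝ] V} {θ : ℝ}
    (hg : HasDerivAt g g' θ) : HasDerivAt (fun t => α.compContinuousLinearMap (g t))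
      (α.fderivCompContinuousLinearMap (g θ) g') θ := by
  have h := ((hasFDerivAt_const α θ).continuousAlternatingMapCompContinuousLinearMap
    hg.hasFDerivAt).hasDerivAt
  rw [ContinuousLinearMap.comp_zero, zero_add, ContinuousLinearMap.comp_apply,
    ContinuousLinearMap.toSpanSingleton_apply, one_smul] at h
  exact h

/-- Since `A² = -1`, the curve is `exp(-tA)`. The minus sign, which comes from acting by inverses,
cancels the one in `lieDer`. -/
theorem hasDerivAt_comp_rotation {V : Type*} [NormedAddCommGroup V] [NormedSpace ℝ V]
    {A : V →L[ℝ] V} (hA : A ∘L A = -.id ℝ V) (α : V [⋀^Fin k]→L[ℝ] ℂ) (θ : ℝ) :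
    HasDerivAt (fun t : ℝ => α.compContinuousLinearMap (Real.cos t • .id ℝ V - Real.sin t • A))
      ((lieDer A α).compContinuousLinearMap (Real.cos θ • .id ℝ V - Real.sin θ • A)) θ := by
  have hg : HasDerivAt (fun t : ℝ => Real.cos t • ContinuousLinearMap.id ℝ V - Real.sin t • A)
      (-(A ∘L (Real.cos θ • .id ℝ V - Real.sin θ • A))) θ := by
    have h1 := ((Real.hasDerivAt_cos θ).smul_const (ContinuousLinearMap.id ℝ V)).sub
      ((Real.hasDerivAt_sin θ).smul_const A)
    have h2 : -(A ∘L (Real.cos θ • .id ℝ V - Real.sin θ • A)) =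
        -Real.sin θ • ContinuousLinearMap.id ℝ V - Real.cos θ • A := by
      rw [ContinuousLinearMap.comp_sub, ContinuousLinearMap.comp_smul,
        ContinuousLinearMap.comp_smul, hA, ContinuousLinearMap.comp_id]
      module
    rw [h2]
    exact h1
  have h := hasDerivAt_compContinuousLinearMap α hg
  rwa [map_neg, fderivCompContinuousLinearMap_comp, neg_neg] at h

theorem hasDerivAt_comp_leftMul {u : ℍ[ℝ]} (hu : u * u = -1) (α : QForm n k) (θ : ℝ) :
    HasDerivAt (fun t : ℝ => α.compContinuousLinearMap
        (leftMul n (Real.cos t • 1 - Real.sin t • u)))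
      ((quatDer u α).compContinuousLinearMap (leftMul n (Real.cos θ • 1 - Real.sin θ • u))) θ := by
  have h (t : ℝ) : leftMul n (Real.cos t • 1 - Real.sin t • u) =
      Real.cos t • .id ℝ _ - Real.sin t • leftMul n u := by
    rw [leftMul_sub, leftMul_smul, leftMul_smul, leftMul_one]
  simp only [h]
  refine hasDerivAt_comp_rotation ?_ α θ
  rw [← leftMul_mul, hu]
  ext1 v
  funext i
  simp [leftMul_apply]

/-- The one-parameter subgroup of `Sp(1)` generated by an imaginary unit. -/
def expUnit (u : ℍ[ℝ]) (hu : u * u = -1) (hu' : star u = -u) (θ : ℝ) : Sp1 :=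
  ⟨Real.cos θ • 1 + Real.sin θ • u, by
    have h := Real.sin_sq_add_cos_sq θ
    have h0 : u.re = 0 := by
      have := congrArg (fun z : ℍ[ℝ] => z.re) hu'
      simp at this
      linarith
    have h1 : u.imI ^ 2 + u.imJ ^ 2 + u.imK ^ 2 = 1 := by
      have := congrArg (fun z : ℍ[ℝ] => z.re) hu
      simp [h0] at this
      linarith
    refine Unitary.mem_iff.mpr ⟨?_, ?_⟩ <;> ext <;> simp [h0] <;>
      first | ring1 | linear_combination Real.sin θ ^ 2 * h1 + h⟩

theorem hasDerivAt_stdRep_expUnit {u : ℍ[ℝ]} (hu : u * u = -1) (hu' : star u = -u)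
    (α : QForm n k) (θ : ℝ) : HasDerivAt (fun t : ℝ => stdRep n k (expUnit u hu hu' t) α)
      (stdRep n k (expUnit u hu hu' θ) (quatDer u α)) θ := by
  have h := hasDerivAt_comp_leftMul hu α θ
  have e (t : ℝ) : star ((expUnit u hu hu' t : Sp1) : ℍ[ℝ]) = Real.cos t • 1 - Real.sin t • u := by
    simp [expUnit, hu', sub_eq_add_neg]
  simp only [stdRep_apply, e]
  exact h

theorem expUnit_qI (hu : qI * qI = -1) (hu' : star qI = -qI) (θ : ℝ) :
    expUnit qI hu hu' θ = expI θ := by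
  have h0 : (expIQuat θ).re = Real.cos θ := rfl
  have h1 : (expIQuat θ).imI = Real.sin θ := rfl
  have h2 : (expIQuat θ).imJ = 0 := rfl
  have h3 : (expIQuat θ).imK = 0 := rfl
  ext <;> simp [expI, expUnit, h0, h1, h2, h3]

theorem star_qI : star qI = -qI := by ext <;> simp
theorem star_qJ : star qJ = -qJ := by ext <;> simp
theorem star_qK : star qK = -qK := by ext <;> simp

/-- The infinitesimal action on the forms on `ℍⁿ`. -/
def stdInfAction (n k : ℕ) : InfAction (X := QForm n k) (stdRep n k) where
  I := quatDer qI
  J := quatDer qJ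
  K := quatDer qK
  hasDerivAt_I α θ := by
    have h := hasDerivAt_stdRep_expUnit qI_mul_qI star_qI α θ
    simp only [expUnit_qI] at h
    exact h
  exists_J := ⟨expUnit qJ qJ_mul_qJ star_qJ, fun α => by
    have h := hasDerivAt_stdRep_expUnit qJ_mul_qJ star_qJ α 0
    rwa [show expUnit qJ qJ_mul_qJ star_qJ 0 = 1 by ext <;> simp [expUnit], map_one] at h⟩
  exists_K := ⟨expUnit qK qK_mul_qK star_qK, fun α => by
    have h := hasDerivAt_stdRep_expUnit qK_mul_qK star_qK α 0
    rwa [show expUnit qK qK_mul_qK star_qK 0 = 1 by ext <;> simp [expUnit], map_one] at h⟩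
  comm_IJ := quatDer_qI_qJ
  comm_JK := quatDer_qJ_qK
  comm_KI := quatDer_qK_qI
  casimir_comm q α := neg_injective (casimir_comp_leftMul (Unitary.star_mem q.2) α)
  exists_isCompl := stdRep_exists_isCompl

/-- The isotypic components of the forms on `ℍⁿ` are the eigenspaces of the Casimir operator. -/
theorem mem_isotypic_stdRep_iff {r : ℤ} (hr : -1 ≤ r) (α : QForm n k) :
    α ∈ isotypic (stdRep n k) r ↔ casimir n k α = (r * (r + 2) : ℂ) • α := by
  have h := (stdInfAction n k).isotypic_eq hr
  have h2 : α ∈ isotypic (stdRep n k) r ↔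
      α ∈ Module.End.eigenspace (stdInfAction n k).C (r * (r + 2) : ℂ) := by
    rw [← h]
  exact h2.trans Module.End.mem_eigenspace_iff

end QuaternionicForms

/-! ### The bundles `E_{k,r}` in a frame -/

section Frames

variable {n k : ℕ}

/-- Transport of forms along a linear isomorphism. -/
def formEquiv {V : Type*} [AddCommGroup V] [Module ℝ V] [TopologicalSpace V]
    (p : V ≃L[ℝ] (Fin n → ℍ[ℝ])) (k : ℕ) : (V [⋀^Fin k]→L[ℝ] ℂ) ≃ₗ[ℂ] QForm n k where
  toFun α := α.compContinuousLinearMap (p.symm : (Fin n → ℍ[ℝ]) →L[ℝ] V)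
  invFun α := α.compContinuousLinearMap (p : V →L[ℝ] (Fin n → ℍ[ℝ]))
  map_add' _ _ := rfl
  map_smul' _ _ := rfl
  left_inv α := by ext v; simp [Function.comp_def]
  right_inv α := by ext v; simp [Function.comp_def]

theorem formEquiv_apply {V : Type*} [AddCommGroup V] [Module ℝ V] [TopologicalSpace V]
    (p : V ≃L[ℝ] (Fin n → ℍ[ℝ])) (α : V [⋀^Fin k]→L[ℝ] ℂ) :
    formEquiv p k α = α.compContinuousLinearMap (p.symm : (Fin n → ℍ[ℝ]) →L[ℝ] V) := rfl

theorem formEquiv_formRep {V : Type*} [AddCommGroup V] [Module ℝ V] [TopologicalSpace V]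
    (p : V ≃L[ℝ] (Fin n → ℍ[ℝ])) (q : Sp1) (α : V [⋀^Fin k]→L[ℝ] ℂ) :
    formEquiv p k (formRep p k q α) = stdRep n k q (formEquiv p k α) := by
  rw [formEquiv_apply, formEquiv_apply]
  ext v
  simp [stdRep, formRep, quatAct, Function.comp_def]

theorem mem_weightForms_iff {V : Type*} [AddCommGroup V] [Module ℝ V] [TopologicalSpace V]
    (p : V ≃L[ℝ] (Fin n → ℍ[ℝ])) (r : ℤ) (α : V [⋀^Fin k]→L[ℝ] ℂ) :
    α ∈ weightForms p k r ↔ formEquiv p k α ∈ isotypic (stdRep n k) r := by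
  refine ⟨fun h => isotypic_le_comap (ρ := formRep p k) (formEquiv p k) (formEquiv_formRep p) r h,
    fun h => ?_⟩
  have := isotypic_le_comap (ρ := stdRep n k) (σ := formRep p k) (formEquiv p k).symm
    (fun q β => (formEquiv p k).injective (by simp [formEquiv_formRep])) r h
  have h' : α ∈ isotypic (formRep p k) r := by simpa using this
  exact h'

/-- Such a pullback preserves Casimir eigenspaces. Negative `r` is separate: the component is zero
there, while the eigenvalue `r(r+2)` may also belong to a nonnegative weight. -/
theorem isotypic_comp_of_casimir {g : (Fin n → ℍ[ℝ]) →L[ℝ] (Fin n → ℍ[ℝ])}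
    (hg : ∀ α : QForm n k, casimir n k (α.compContinuousLinearMap g) =
      (casimir n k α).compContinuousLinearMap g) {r : ℤ} {α : QForm n k}
    (hα : α ∈ isotypic (stdRep n k) r) :
    α.compContinuousLinearMap g ∈ isotypic (stdRep n k) r := by
  rcases lt_or_ge r 0 with hr | hr
  · rw [isotypic_eq_bot hr, Submodule.mem_bot] at hα ⊢
    rw [hα]
    rfl
  · rw [mem_isotypic_stdRep_iff (by omega)] at hα ⊢
    rw [hg, hα]
    rfl

theorem exists_vecMulCLM (B : Matrix (Fin n) (Fin n) ℍ[ℝ]) :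
    ∃ R : (Fin n → ℍ[ℝ]) →L[ℝ] (Fin n → ℍ[ℝ]), (∀ v, R v = Matrix.vecMul v B) ∧
      ∀ a, R ∘L leftMul n a = leftMul n a ∘L R := by
  refine ⟨LinearMap.toContinuousLinearMap
    { toFun := fun v => Matrix.vecMul v B
      map_add' := fun v w => Matrix.add_vecMul _ _ _
      map_smul' := fun c v => Matrix.smul_vecMul _ _ _ }, fun v => rfl, fun a => ?_⟩
  ext1 v
  funext j
  change ∑ i, (a * v i) * B i j = a * ∑ i, v i * B i j
  rw [Finset.mul_sum]
  exact Finset.sum_congr rfl fun i _ => mul_assoc _ _ _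

theorem isotypic_comp_sp1GL {g : (Fin n → ℍ[ℝ]) ≃L[ℝ] (Fin n → ℍ[ℝ])} (hg : g ∈ sp1GL n) {r : ℤ}
    {α : QForm n k} (hα : α ∈ isotypic (stdRep n k) r) :
    α.compContinuousLinearMap (g : (Fin n → ℍ[ℝ]) →L[ℝ] (Fin n → ℍ[ℝ])) ∈
      isotypic (stdRep n k) r := by
  obtain ⟨q, A, h⟩ := hg
  obtain ⟨R, hR, hRc⟩ := exists_vecMulCLM (A : Matrix (Fin n) (Fin n) ℍ[ℝ])
  have hgR : (g : (Fin n → ℍ[ℝ]) →L[ℝ] (Fin n → ℍ[ℝ])) = leftMul n q ∘L R := by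
    ext1 v
    rw [ContinuousLinearMap.comp_apply, hR]
    exact h v
  have := isotypic_comp_of_casimir (casimir_comp_of_commute hRc)
    (isotypic_comp_of_casimir (casimir_comp_leftMul q.2) hα)
  rw [hgR]
  exact this

variable {E : Type*} [NormedAddCommGroup E] [NormedSpace ℝ E]
  {M : Type*} [TopologicalSpace M] [ChartedSpace E M]

/-- Two frames of `Q` differ by an element of `Sp(1)GL(n, ℍ)`, whose pullback preserves isotypic
components; all members of the supremum over frames therefore coincide. -/
theorem mem_bundleC_iff [IsManifold 𝓘(ℝ, E) 1 M] (Q : Sp1GLStructure E M n) {x : M}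
    {p : TangentSpace 𝓘(ℝ, E) x ≃L[ℝ] (Fin n → ℍ[ℝ])} (hp : p ∈ Q.frames x) (r : ℤ)
    (α : TangentSpace 𝓘(ℝ, E) x [⋀^Fin k]→L[ℝ] ℂ) :
    α ∈ bundleC Q k r x ↔ formEquiv p k α ∈ isotypic (stdRep n k) r := by
  rw [← mem_weightForms_iff]
  refine ⟨fun h => ?_, fun h => Submodule.mem_iSup_of_mem p (Submodule.mem_iSup_of_mem hp h)⟩
  suffices hle : bundleC Q k r x ≤ weightForms p k r from hle h
  refine iSup₂_le fun p' hp' β hβ => ?_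
  obtain ⟨g, hg, rfl⟩ := (Q.mem_iff x p hp p').1 hp'
  rw [mem_weightForms_iff] at hβ ⊢
  have := isotypic_comp_sp1GL hg hβ
  convert this using 1
  rw [formEquiv_apply, formEquiv_apply]
  ext v
  simp [Function.comp_def]

end Frames

/-! ### Alternation, disjointness and conjugation -/

section Standard

open ContinuousAlternatingMap

variable {n k : ℕ}

theorem alternatizeUncurryFin_mem {T : (Fin n → ℍ[ℝ]) →L[ℝ] QForm n k} {r : ℤ}
    (hT : ∀ v, T v ∈ isotypic (stdRep n k) r) :
    alternatizeUncurryFin T ∈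
      isotypic (stdRep n (k + 1)) (r + 1) ⊔ isotypic (stdRep n (k + 1)) (r - 1) := by
  rcases lt_or_ge r 0 with hr | hr
  · have : T = 0 := by
      refine ContinuousLinearMap.ext fun v => ?_
      have := hT v
      rw [isotypic_eq_bot hr, Submodule.mem_bot] at this
      rw [this]
      rfl
    have h0 : alternatizeUncurryFin T = 0 := by
      ext v
      simp [this, alternatizeUncurryFin_apply]
    rw [h0]
    exact Submodule.zero_mem _
  · obtain ⟨β, γ, h, hβ, hγ⟩ := exists_casimir_decomposition hr
      fun v => (mem_isotypic_stdRep_iff (by omega) _).1 (hT v)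
    rw [h]
    refine Submodule.add_mem_sup ((mem_isotypic_stdRep_iff (by omega) _).2 ?_)
      ((mem_isotypic_stdRep_iff (by omega) _).2 ?_)
    · rw [hβ]
      congr 1
      push_cast
      ring
    · rw [hγ]
      congr 1
      push_cast
      ring

theorem isotypic_disjoint (n k : ℕ) (r : ℤ) :
    Disjoint (isotypic (stdRep n k) (r + 1)) (isotypic (stdRep n k) (r - 1)) := by
  rcases le_or_gt r 0 with hr | hr
  · rw [isotypic_eq_bot (show r - 1 < 0 by omega)]
    exact disjoint_bot_right
  · rw [Submodule.disjoint_def]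
    intro α h1 h2
    rw [mem_isotypic_stdRep_iff (by omega)] at h1 h2
    rw [h1] at h2
    -- The two eigenvalues `(r+1)(r+3)` and `(r-1)(r+1)` differ by `4(r+1)`.
    have h3 : (4 * (r + 1) : ℂ) • α = 0 := by
      have := sub_eq_zero.2 h2
      rw [← this]
      push_cast
      module
    refine (smul_eq_zero.1 h3).resolve_left ?_
    have : (4 * (r + 1) : ℤ) ≠ 0 := by omega
    exact_mod_cast this

/-- Complex conjugation of forms. -/
def conjForm {V : Type*} [AddCommGroup V] [Module ℝ V] [TopologicalSpace V]
    (α : V [⋀^Fin k]→L[ℝ] ℂ) : V [⋀^Fin k]→L[ℝ] ℂ :=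
  (Complex.conjCLE : ℂ →L[ℝ] ℂ).compContinuousAlternatingMap α

theorem conjForm_apply {V : Type*} [AddCommGroup V] [Module ℝ V] [TopologicalSpace V]
    (α : V [⋀^Fin k]→L[ℝ] ℂ) (v : Fin k → V) : conjForm α v = (starRingEnd ℂ) (α v) := rfl

theorem quatDer_conjForm (a : ℍ[ℝ]) (α : QForm n k) :
    quatDer a (conjForm α) = conjForm (quatDer a α) := by
  ext v
  simp only [quatDer, lieDer_apply, conjForm_apply, _root_.map_neg, _root_.map_sum]

/-- The quaternions act on the real space `ℍⁿ`, so the operator is defined over the reals. -/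
theorem casimir_conjForm (α : QForm n k) :
    casimir n k (conjForm α) = conjForm (casimir n k α) := by
  simp only [casimir_apply, quatDer_conjForm]
  ext v
  simp [conjForm_apply]

theorem conjForm_mem_isotypic {α : QForm n k} {r : ℤ} (hα : α ∈ isotypic (stdRep n k) r) :
    conjForm α ∈ isotypic (stdRep n k) r := by
  rcases lt_or_ge r 0 with hr | hr
  · rw [isotypic_eq_bot hr, Submodule.mem_bot] at hα ⊢
    ext v
    simp [hα, conjForm_apply]
  · rw [mem_isotypic_stdRep_iff (by omega)] at hα ⊢
    rw [casimir_conjForm, hα]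
    ext v
    simp [conjForm_apply, Complex.conj_ofNat]

end Standard

/-! ### Forms on `ℍ` -/

section DimensionOne

variable {k : ℕ}

/-- Alternating the curried form returns `(k+1)ζ`, so every `(k+1)`-form comes from a map into
`k`-forms, to which the Clebsch–Gordan rule applies. -/
theorem full_succ {n : ℕ} {s : ℤ} (h : ∀ β : QForm n k, β ∈ isotypic (stdRep n k) s)
    (ζ : QForm n (k + 1)) :
    ζ ∈ isotypic (stdRep n (k + 1)) (s + 1) ⊔ isotypic (stdRep n (k + 1)) (s - 1) := by
  have h1 := alternatizeUncurryFin_mem (T := ζ.curryLeft) fun v => h _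
  rw [ContinuousAlternatingMap.alternatizeUncurryFin_curryLeft] at h1
  have h2 := Submodule.smul_mem _ (((k : ℂ) + 1)⁻¹) h1
  have h3 : (k : ℂ) + 1 ≠ 0 := by exact_mod_cast k.succ_ne_zero
  convert h2 using 1
  ext v
  simp
  field_simp

theorem full_zero {n : ℕ} (β : QForm n 0) : β ∈ isotypic (stdRep n 0) 0 := by
  rw [mem_isotypic_stdRep_iff (by omega)]
  have h (a : ℍ[ℝ]) (β : QForm n 0) : quatDer a β = 0 := by
    ext v
    simp [quatDer, lieDer_apply]
  rw [casimir_apply, h, h, h]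
  ext v
  simp

theorem full_one {n : ℕ} (β : QForm n 1) : β ∈ isotypic (stdRep n 1) 1 := by
  have h := full_succ full_zero β
  rw [isotypic_eq_bot (show (0 : ℤ) - 1 < 0 by omega), sup_bot_eq] at h
  exact h

/-- Slots `i` and `j` contain `x` and `Ax`. Applying `A` in either one repeats the other up to sign
and kills the term, so only the third slot contributes. -/
theorem lieDer_of_complex_pair {V : Type*} [NormedAddCommGroup V] [NormedSpace ℝ V]
    {A : V →L[ℝ] V} (hA : ∀ v, A (A v) = -v) (α : V [⋀^Fin 3]→L[ℝ] ℂ) {v : Fin 3 → V}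
    {i j l : Fin 3} (hij : i ≠ j) (hli : l ≠ i) (hlj : l ≠ j) (hv : v j = A (v i)) :
    lieDer A α v = -α (Function.update v l (A (v l))) := by
  rw [lieDer_apply, Finset.sum_eq_single l]
  · intro m _ hm
    have hm' : m = i ∨ m = j := by omega
    rcases hm' with rfl | rfl
    · refine α.map_eq_zero_of_eq _ (i := m) (j := j) ?_ hij
      rw [Function.update_self, Function.update_of_ne hij.symm, hv]
    · rw [hv, hA, ← neg_one_smul ℝ (v i), α.map_update_smul]
      rw [α.map_eq_zero_of_eq _ (i := i) (j := m) ?_ hij, smul_zero]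
      rw [Function.update_self, Function.update_of_ne hij]
  · simp

theorem exists_ne_both : ∀ i j : Fin 3, ∃ l, l ≠ i ∧ l ≠ j := by decide

theorem lieDer_lieDer_of_complex_pair {V : Type*} [NormedAddCommGroup V] [NormedSpace ℝ V]
    {A : V →L[ℝ] V} (hA : ∀ v, A (A v) = -v) (α : V [⋀^Fin 3]→L[ℝ] ℂ) {v : Fin 3 → V}
    {i j : Fin 3} (hij : i ≠ j) (hv : v j = A (v i)) :
    lieDer A (lieDer A α) v = -α v := by
  obtain ⟨l, hli, hlj⟩ : ∃ l, l ≠ i ∧ l ≠ j := exists_ne_both i j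
  rw [lieDer_of_complex_pair hA _ hij hli hlj hv, lieDer_of_complex_pair hA _ hij hli hlj,
    Function.update_self, Function.update_idem, hA, ← neg_one_smul ℝ (v l), α.map_update_smul,
    Function.update_eq_self]
  · simp
  · rw [Function.update_of_ne hlj.symm, Function.update_of_ne hli.symm, hv]

/-- The standard real basis of `ℍ¹`. -/
def hBasisOne : Module.Basis (Fin 4) ℝ (Fin 1 → ℍ[ℝ]) :=
  hBasis.map (LinearEquiv.funUnique (Fin 1) ℝ ℍ[ℝ]).symm

theorem hBasisOne_apply (a : Fin 4) (i : Fin 1) : hBasisOne a i = ![1, qI, qJ, qK] a := by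
  rw [← hBasis_apply]
  rfl

/-- Multiplication by `u` splits `1, i, j, k` into two pairs, up to sign. Three distinct basis
vectors contain one of these pairs, and `A² = -1` acts on the remaining slot. -/
theorem quatDer_quatDer_three {u : ℍ[ℝ]} (hu : u * u = -1) (σ : Fin 4 → Fin 4)
    (hσ : ∀ f : Fin 3 → Fin 4, Function.Injective f → ∃ i j, i ≠ j ∧ f j = σ (f i))
    (hpair : ∀ a, u * ![1, qI, qJ, qK] a = ![1, qI, qJ, qK] (σ a) ∨
      u * ![1, qI, qJ, qK] (σ a) = ![1, qI, qJ, qK] a) (α : QForm 1 3) :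
    quatDer u (quatDer u α) = -α := by
  have hA (v : Fin 1 → ℍ[ℝ]) : leftMul 1 u (leftMul 1 u v) = -v := by
    rw [leftMul_leftMul, hu, leftMul_neg_apply, leftMul_one_apply]
  apply ContinuousAlternatingMap.toAlternatingMap_injective
  refine Module.Basis.ext_alternating hBasisOne fun f hf => ?_
  obtain ⟨i, j, hij, hfij⟩ := hσ f hf
  rcases hpair (f i) with h | h
  · refine lieDer_lieDer_of_complex_pair (v := fun l => hBasisOne (f l)) hA α hij (funext fun m => ?_)
    rw [leftMul_apply, hBasisOne_apply, hBasisOne_apply, h, hfij]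
  · refine lieDer_lieDer_of_complex_pair (v := fun l => hBasisOne (f l)) hA α hij.symm
      (funext fun m => ?_)
    rw [leftMul_apply, hBasisOne_apply, hBasisOne_apply, hfij, h]

theorem full_three (β : QForm 1 3) : β ∈ isotypic (stdRep 1 3) 1 := by
  rw [mem_isotypic_stdRep_iff (by omega), casimir_apply,
    quatDer_quatDer_three qI_mul_qI ![1, 0, 3, 2] (by decide) (by
      intro a; fin_cases a <;> simp [qI_mul_qJ]),
    quatDer_quatDer_three qJ_mul_qJ ![2, 3, 0, 1] (by decide) (by
      intro a; fin_cases a <;> simp [qJ_mul_qK]),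
    quatDer_quatDer_three qK_mul_qK ![3, 2, 1, 0] (by decide) (by
      intro a; fin_cases a <;> simp [qK_mul_qI])]
  push_cast
  module

theorem eq_zero_of_four_lt {k : ℕ} (hk : 4 < k) (β : QForm 1 k) : β = 0 := by
  apply ContinuousAlternatingMap.toAlternatingMap_injective
  refine Module.Basis.ext_alternating hBasisOne fun f hf => ?_
  have := Fintype.card_le_of_injective f hf
  simp at this
  omega

/-- In dimension four every form of degree `k + 1` has the weights allowed by a nonzero form of
degree `k`. -/
theorem mem_of_exists_ne_zero {r : ℤ} {α : QForm 1 k} (hα : α ∈ isotypic (stdRep 1 k) r)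
    (h0 : α ≠ 0) (ζ : QForm 1 (k + 1)) :
    ζ ∈ isotypic (stdRep 1 (k + 1)) (r + 1) ⊔ isotypic (stdRep 1 (k + 1)) (r - 1) := by
  have hr : 0 ≤ r := by
    by_contra hr
    rw [isotypic_eq_bot (by omega), Submodule.mem_bot] at hα
    exact h0 hα
  -- A nonzero form has at most one nonnegative weight, because the eigenvalue determines it.
  have huniq {s : ℤ} (hs : 0 ≤ s) (h : α ∈ isotypic (stdRep 1 k) s) : r = s := by
    rw [mem_isotypic_stdRep_iff (by omega)] at hα h
    rw [hα] at h
    have h1 : ((r * (r + 2) : ℂ) - (s * (s + 2) : ℂ)) • α = 0 := by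
      have := sub_eq_zero.2 h
      rw [← this]
      module
    have h2 : (r * (r + 2) : ℂ) = s * (s + 2) :=
      sub_eq_zero.1 ((smul_eq_zero.1 h1).resolve_right h0)
    have h3 : r * (r + 2) = s * (s + 2) := by exact_mod_cast h2
    have h4 : (r - s) * (r + s + 2) = 0 := by linear_combination h3
    rcases mul_eq_zero.1 h4 with h | h <;> omega
  match k, α, ζ with
  | 0, α, ζ => rw [huniq le_rfl (full_zero α)]; exact full_succ full_zero ζ
  | 1, α, ζ => rw [huniq (by omega) (full_one α)]; exact full_succ full_one ζ
  | 2, α, ζ =>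
    -- On two-forms the Casimir operator has only the eigenvalues `8` and `0`, so `r(r+2)(r(r+2) -
    -- 8) = 0`. Either weight is adjacent to `1`, the only weight on three-forms.
    have hr02 : r = 2 ∨ r = 0 := by
      obtain ⟨β, hβ, γ, hγ, rfl⟩ := Submodule.mem_sup.1 (full_succ full_one α)
      rw [mem_isotypic_stdRep_iff (by omega)] at hβ hγ hα
      have e1 : casimir 1 2 (β + γ) = (8 : ℂ) • β := by
        refine (LinearMap.map_add _ _ _).trans ?_
        rw [hβ, hγ]
        push_cast
        module
      have e2 : (r * (r + 2) : ℂ) • (β + γ) = (8 : ℂ) • β := hα.symm.trans e1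
      have e3 : (r * (r + 2) : ℂ) • (8 : ℂ) • β = (64 : ℂ) • β := by
        rw [← e1, ← (casimir 1 2).map_smul, e2]
        refine (LinearMap.map_smul _ _ _).trans ?_
        rw [hβ]
        push_cast
        module
      have h2 : ((r * (r + 2) : ℂ) * (r * (r + 2) - 8)) • (β + γ) = 0 := by
        have e4 : (r * (r + 2) - 8 : ℂ) • (8 : ℂ) • β =
            (r * (r + 2) : ℂ) • (8 : ℂ) • β - (64 : ℂ) • β := by module
        rw [mul_comm, mul_smul, e2, e4, e3, sub_self]
      have h3 := (smul_eq_zero.1 h2).resolve_right h0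
      have h4 : r * (r + 2) * (r * (r + 2) - 8) = 0 := by exact_mod_cast h3
      have h5 : r * ((r + 2) * ((r - 2) * (r + 4))) = 0 := by linear_combination h4
      simp only [mul_eq_zero] at h5
      omega
    rcases hr02 with rfl | rfl
    · exact Submodule.mem_sup_right (full_three ζ)
    · exact Submodule.mem_sup_left (full_three ζ)
  | 3, α, ζ => rw [huniq (by omega) (full_three α)]; exact full_succ full_three ζ
  | k + 4, α, ζ =>
    rw [eq_zero_of_four_lt (by omega) ζ]
    exact Submodule.zero_mem _

end DimensionOne

/-! ### The exterior derivative in charts -/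

set_option synthInstance.maxHeartbeats 200000 in
theorem contDiffAt_extDeriv {E : Type*} [NormedAddCommGroup E] [NormedSpace ℝ E]
    {F : Type*} [NormedAddCommGroup F] [NormedSpace ℝ F] {k : ℕ} {f : E → E [⋀^Fin k]→L[ℝ] F}
    {y : E} (hf : ContDiffAt ℝ ∞ f y) : ContDiffAt ℝ ∞ (extDeriv f) y := by
  have h1 : ContDiffAt ℝ ∞ (fderiv ℝ f) y := hf.fderiv_right (by simp)
  exact (ContinuousAlternatingMap.alternatizeUncurryFinCLM ℝ E F (n := k)
    ).contDiff.contDiffAt.comp y h1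

section Charts

open Filter Topology

variable {E : Type*} [NormedAddCommGroup E] [NormedSpace ℝ E]
  {M : Type*} [TopologicalSpace M] [ChartedSpace E M]
  {F : Type*} [NormedAddCommGroup F] [NormedSpace ℝ F] {k : ℕ}

/-- The derivative at `p` of the chart around `x`, as an endomorphism of the model space. -/
def chartDeriv (x p : M) : E →L[ℝ] E :=
  mfderiv 𝓘(ℝ, E) 𝓘(ℝ, E) (extChartAt 𝓘(ℝ, E) x) p

/-- The derivative at `y` of the inverse of the chart around `x`, as an endomorphism of the model
space. -/
def chartSymmDeriv (x : M) (y : E) : E →L[ℝ] E :=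
  mfderiv 𝓘(ℝ, E) 𝓘(ℝ, E) (extChartAt 𝓘(ℝ, E) x).symm y

/-- The value of a form at a point, on the model space. -/
def DForm.val (α : DForm E M F k) (p : M) : E [⋀^Fin k]→L[ℝ] F := α p

theorem DForm.inChart_eq (α : DForm E M F k) (x : M) (y : E) :
    α.inChart x y = (α.val ((extChartAt 𝓘(ℝ, E) x).symm y)).compContinuousLinearMap
      (chartSymmDeriv x y) := rfl

theorem DForm.val_d (α : DForm E M F k) (x : M) :
    (DForm.d α).val x = (extDeriv (α.inChart x) (extChartAt 𝓘(ℝ, E) x x)).compContinuousLinearMap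
      (chartDeriv x x) := rfl

theorem eventually_mem_target {x : M} {y : E} (hy : y ∈ (extChartAt 𝓘(ℝ, E) x).target) :
    ∀ᶠ z in 𝓝 y, z ∈ (extChartAt 𝓘(ℝ, E) x).target :=
  (isOpen_extChartAt_target x).mem_nhds hy

theorem DForm.IsSmooth.contDiffAt {α : DForm E M F k} (hα : α.IsSmooth) {x : M} {y : E}
    (hy : y ∈ (extChartAt 𝓘(ℝ, E) x).target) : ContDiffAt ℝ ∞ (α.inChart x) y :=
  (hα x).contDiffAt (eventually_mem_target hy)

variable [IsManifold 𝓘(ℝ, E) ∞ M]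

theorem chartDeriv_comp_chartSymmDeriv {x : M} {y : E} (hy : y ∈ (extChartAt 𝓘(ℝ, E) x).target) :
    chartDeriv x ((extChartAt 𝓘(ℝ, E) x).symm y) ∘L chartSymmDeriv x y =
      ContinuousLinearMap.id ℝ E := by
  have := mfderiv_extChartAt_comp_mfderivWithin_extChartAt_symm hy
  simp only [modelWithCornersSelf_coe, range_id, mfderivWithin_univ] at this
  exact this

theorem chartSymmDeriv_comp_chartDeriv {x : M} {y : E} (hy : y ∈ (extChartAt 𝓘(ℝ, E) x).target) :
    chartSymmDeriv x y ∘L chartDeriv x ((extChartAt 𝓘(ℝ, E) x).symm y) =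
      ContinuousLinearMap.id ℝ E := by
  have := mfderivWithin_extChartAt_symm_comp_mfderiv_extChartAt hy
  simp only [modelWithCornersSelf_coe, range_id, mfderivWithin_univ] at this
  exact this

theorem chartSymmDeriv_comp_chartDeriv' {x p : M} (hp : p ∈ (extChartAt 𝓘(ℝ, E) x).source) :
    chartSymmDeriv x (extChartAt 𝓘(ℝ, E) x p) ∘L chartDeriv x p = ContinuousLinearMap.id ℝ E := by
  have := chartSymmDeriv_comp_chartDeriv ((extChartAt 𝓘(ℝ, E) x).map_source hp)
  rwa [(extChartAt 𝓘(ℝ, E) x).left_inv hp] at this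

theorem mdifferentiableAt_extChartAt_symm {x : M} {y : E}
    (hy : y ∈ (extChartAt 𝓘(ℝ, E) x).target) :
    MDifferentiableAt 𝓘(ℝ, E) 𝓘(ℝ, E) (extChartAt 𝓘(ℝ, E) x).symm y := by
  have := mdifferentiableWithinAt_extChartAt_symm hy
  simpa only [modelWithCornersSelf_coe, range_id, mdifferentiableWithinAt_univ] using this

theorem contDiffAt_coordChange {x x' : M} {y : E} (hy : y ∈ (extChartAt 𝓘(ℝ, E) x).target)
    (hy' : (extChartAt 𝓘(ℝ, E) x).symm y ∈ (extChartAt 𝓘(ℝ, E) x').source) :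
    ContDiffAt ℝ ∞ (extChartAt 𝓘(ℝ, E) x' ∘ (extChartAt 𝓘(ℝ, E) x).symm) y := by
  have := contDiffWithinAt_ext_coord_change (I := 𝓘(ℝ, E)) (n := ∞) x' x (y := y) (by
    simp [PartialEquiv.trans_source] at hy hy' ⊢
    exact ⟨hy, hy'⟩)
  simpa only [modelWithCornersSelf_coe, range_id, contDiffWithinAt_univ] using this

theorem fderiv_coordChange {x x' : M} {y : E} (hy : y ∈ (extChartAt 𝓘(ℝ, E) x).target)
    (hy' : (extChartAt 𝓘(ℝ, E) x).symm y ∈ (extChartAt 𝓘(ℝ, E) x').source) :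
    fderiv ℝ (extChartAt 𝓘(ℝ, E) x' ∘ (extChartAt 𝓘(ℝ, E) x).symm) y =
      chartDeriv x' ((extChartAt 𝓘(ℝ, E) x).symm y) ∘L chartSymmDeriv x y := by
  rw [← mfderiv_eq_fderiv]
  refine mfderiv_comp y (mdifferentiableAt_extChartAt ?_) (mdifferentiableAt_extChartAt_symm hy)
  rwa [extChartAt_source] at hy'

theorem DForm.inChart_coordChange (α : DForm E M F k) {x x' : M} {y : E}
    (hy : y ∈ (extChartAt 𝓘(ℝ, E) x).target)
    (hy' : (extChartAt 𝓘(ℝ, E) x).symm y ∈ (extChartAt 𝓘(ℝ, E) x').source) :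
    α.inChart x y =
      (α.inChart x' ((extChartAt 𝓘(ℝ, E) x' ∘ (extChartAt 𝓘(ℝ, E) x).symm) y)
        ).compContinuousLinearMap
        (fderiv ℝ (extChartAt 𝓘(ℝ, E) x' ∘ (extChartAt 𝓘(ℝ, E) x).symm) y) := by
  have h : ∀ v, chartSymmDeriv x' (extChartAt 𝓘(ℝ, E) x' ((extChartAt 𝓘(ℝ, E) x).symm y))
      (chartDeriv x' ((extChartAt 𝓘(ℝ, E) x).symm y) v) = v :=
    fun v => congrArg (fun L : E →L[ℝ] E => L v) (chartSymmDeriv_comp_chartDeriv' hy')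
  rw [fderiv_coordChange hy hy', DForm.inChart_eq, DForm.inChart_eq, Function.comp_apply,
    (extChartAt 𝓘(ℝ, E) x').left_inv hy']
  ext v
  simp only [ContinuousAlternatingMap.compContinuousLinearMap_apply, Function.comp_def,
    ContinuousLinearMap.comp_apply, h]

theorem continuousAt_symm {x : M} {y : E} (hy : y ∈ (extChartAt 𝓘(ℝ, E) x).target) :
    ContinuousAt (extChartAt 𝓘(ℝ, E) x).symm y :=
  (mdifferentiableAt_extChartAt_symm hy).continuousAt

/-- The exterior derivative can be computed in any chart. -/
theorem DForm.IsSmooth.inChart_d {α : DForm E M F k} (hα : α.IsSmooth) {x : M} {y : E}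
    (hy : y ∈ (extChartAt 𝓘(ℝ, E) x).target) :
    (DForm.d α).inChart x y = extDeriv (α.inChart x) y := by
  -- The exterior derivative at `p` is defined in the chart around `p`. Pullback along the
  -- transition map carries it to the chart around `x`.
  set p := (extChartAt 𝓘(ℝ, E) x).symm y with hp
  have hy' : (extChartAt 𝓘(ℝ, E) x).symm y ∈ (extChartAt 𝓘(ℝ, E) p).source :=
    mem_extChartAt_source p
  have hev : α.inChart x =ᶠ[𝓝 y] fun z =>
      (α.inChart p ((extChartAt 𝓘(ℝ, E) p ∘ (extChartAt 𝓘(ℝ, E) x).symm) z)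
        ).compContinuousLinearMap
        (fderiv ℝ (extChartAt 𝓘(ℝ, E) p ∘ (extChartAt 𝓘(ℝ, E) x).symm) z) := by
    filter_upwards [eventually_mem_target hy, (continuousAt_symm hy).eventually
      ((isOpen_extChartAt_source p).mem_nhds hy')] with z hz hz'
    exact α.inChart_coordChange hz hz'
  have hd : DifferentiableAt ℝ (α.inChart p)
      ((extChartAt 𝓘(ℝ, E) p ∘ (extChartAt 𝓘(ℝ, E) x).symm) y) :=
    (hα.contDiffAt (mem_extChartAt_target p)).differentiableAt (by simp)
  rw [hev.extDeriv_eq, extDeriv_pullback hd (contDiffAt_coordChange hy hy') (by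
    rw [minSmoothness_of_isRCLikeNormedField]; exact WithTop.coe_le_coe.2 le_top),
    fderiv_coordChange hy hy', DForm.inChart_eq, DForm.val_d]
  rfl

/-- The exterior derivative of a smooth form is smooth. -/
theorem DForm.IsSmooth.d {α : DForm E M F k} (hα : α.IsSmooth) : (DForm.d α).IsSmooth := by
  intro x
  have h : ContDiffOn ℝ ∞ (extDeriv (α.inChart x)) (extChartAt 𝓘(ℝ, E) x).target := by
    intro y hy
    exact (contDiffAt_extDeriv (hα.contDiffAt hy)).contDiffWithinAt
  exact h.congr fun y hy => hα.inChart_d hy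

end Charts

/-! ### Torsion-free connections in a moving frame -/

set_option synthInstance.maxHeartbeats 200000 in
/-- The exterior derivative of a form read in a moving frame `Z`, in terms of a torsion-free
connection with connection form `A`. -/
theorem exists_extDeriv_comp_eq {V E : Type*} [NormedAddCommGroup V] [NormedSpace ℝ V]
    [NormedAddCommGroup E] [NormedSpace ℝ E] {k : ℕ} {f : E → E [⋀^Fin k]→L[ℝ] ℂ}
    {Z : E → V →L[ℝ] E} {y : E} (hf : DifferentiableAt ℝ f y) (hZ : DifferentiableAt ℝ Z y)
    (A : V →L[ℝ] V →L[ℝ] V)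
    (hA : ∀ w v, fderiv ℝ Z y (Z y w) v - Z y (A w v) = fderiv ℝ Z y (Z y v) w - Z y (A v w)) :
    ∃ T : V →L[ℝ] V [⋀^Fin k]→L[ℝ] ℂ,
      (∀ w, T w = fderiv ℝ (fun z => (f z).compContinuousLinearMap (Z z)) y (Z y w) +
        lieDer (A w) ((f y).compContinuousLinearMap (Z y))) ∧
      (extDeriv f y).compContinuousLinearMap (Z y) =
        ContinuousAlternatingMap.alternatizeUncurryFin T := by
  -- `H` is the derivative of the frame corrected by the connection form. By `hA` it is symmetric,
  -- so the term it contributes to `T` vanishes under alternation.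
  let H : V →L[ℝ] V →L[ℝ] E :=
    fderiv ℝ Z y ∘L Z y - ContinuousLinearMap.compL ℝ V V E (Z y) ∘L A
  have hH (w : V) : H w = fderiv ℝ Z y (Z y w) - Z y ∘L A w := rfl
  refine ⟨ContinuousAlternatingMap.compContinuousLinearMapCLM (Z y) ∘L fderiv ℝ f y ∘L Z y +
    (f y).fderivCompContinuousLinearMap (Z y) ∘L H, fun w => ?_, ?_⟩
  · rw [fderiv_continuousAlternatingMapCompContinuousLinearMap hf hZ]
    simp only [_root_.add_apply, ContinuousLinearMap.comp_apply, hH, map_sub, add_assoc]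
    congr 1
    rw [sub_eq_add_neg]
    congr 1
    ext v
    simp only [lieDer_apply, ContinuousAlternatingMap.neg_apply,
      ContinuousAlternatingMap.fderivCompContinuousLinearMap_apply,
      ContinuousAlternatingMap.compContinuousLinearMap_apply]
    congr 1
    refine Finset.sum_congr rfl fun i _ => congrArg (f y) (funext fun j => ?_)
    rcases eq_or_ne j i with rfl | h <;> simp [*]
  · rw [ContinuousAlternatingMap.alternatizeUncurryFin_add,
      ContinuousAlternatingMap.alternatizeUncurryFin_fderivCompContinuousLinearMap_eq_zero _ _
        fun w v => hA w v, add_zero, extDeriv]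
    ext v
    simp +unfoldPartialApp [ContinuousAlternatingMap.alternatizeUncurryFin_apply, Fin.removeNth,
      Function.comp_def]

/-- In a basis `b` of `V`, `Z` is a finite sum of coordinate functionals tensored with the vectors
`Z b_i`. -/
theorem differentiableAt_of_forall_apply {V E G : Type*} [NormedAddCommGroup V] [NormedSpace ℝ V]
    [FiniteDimensional ℝ V] [NormedAddCommGroup E] [NormedSpace ℝ E] [NormedAddCommGroup G]
    [NormedSpace ℝ G] {Z : G → V →L[ℝ] E} {y : G}
    (hZ : ∀ v, DifferentiableAt ℝ (fun z => Z z v) y) : DifferentiableAt ℝ Z y := by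
  let b := Module.finBasis ℝ V
  let c (i) : V →L[ℝ] ℝ := LinearMap.toContinuousLinearMap (b.coord i)
  have h : Z = fun z => ∑ i, ContinuousLinearMap.smulRightL ℝ V E (c i) (Z z (b i)) := by
    funext z
    ext v
    conv_lhs => rw [← b.sum_repr v, map_sum]
    simp [c]
  rw [h]
  exact DifferentiableAt.fun_sum fun i _ =>
    (ContinuousLinearMap.smulRightL ℝ V E (c i)).differentiableAt.comp y (hZ (b i))

/-! ### Moving frames and their brackets in a chart -/

section Frame

open Filter Topology VectorField

variable {V : Type*} [NormedAddCommGroup V] [NormedSpace ℝ V]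
  {E : Type*} [NormedAddCommGroup E] [NormedSpace ℝ E]
  {M : Type*} [TopologicalSpace M] [ChartedSpace E M]

/-- The inverse of a frame, with values in the model space. -/
def frameInv (s : ∀ p : M, TangentSpace 𝓘(ℝ, E) p ≃L[ℝ] V) (p : M) : V →L[ℝ] E :=
  ((s p).symm : V →L[ℝ] TangentSpace 𝓘(ℝ, E) p)

/-- The inverse of a frame read in the chart around `x`. -/
def frameInChart (s : ∀ p : M, TangentSpace 𝓘(ℝ, E) p ≃L[ℝ] V) (x : M) (y : E) : V →L[ℝ] E :=
  chartDeriv x ((extChartAt 𝓘(ℝ, E) x).symm y) ∘L frameInv s ((extChartAt 𝓘(ℝ, E) x).symm y)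

variable [IsManifold 𝓘(ℝ, E) ∞ M]

/-- The derivatives of the chart and of its inverse cancel: the components of a form in a frame do
not depend on the chart. -/
theorem inChart_comp_frameInChart {k : ℕ} (α : DForm E M ℂ k)
    (s : ∀ p : M, TangentSpace 𝓘(ℝ, E) p ≃L[ℝ] V) {x : M} {y : E}
    (hy : y ∈ (extChartAt 𝓘(ℝ, E) x).target) :
    (α.inChart x y).compContinuousLinearMap (frameInChart s x y) =
      (α.val ((extChartAt 𝓘(ℝ, E) x).symm y)).compContinuousLinearMap
        (frameInv s ((extChartAt 𝓘(ℝ, E) x).symm y)) := by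
  have h : ∀ v, chartSymmDeriv x y (chartDeriv x ((extChartAt 𝓘(ℝ, E) x).symm y) v) = v :=
    fun v => congrArg (fun L : E →L[ℝ] E => L v) (chartSymmDeriv_comp_chartDeriv hy)
  rw [DForm.inChart_eq, frameInChart]
  ext v
  simp only [ContinuousAlternatingMap.compContinuousLinearMap_apply, Function.comp_def,
    ContinuousLinearMap.comp_apply, h]

theorem inverse_chartSymmDeriv {x : M} {y : E} (hy : y ∈ (extChartAt 𝓘(ℝ, E) x).target) :
    (chartSymmDeriv x y).inverse = chartDeriv x ((extChartAt 𝓘(ℝ, E) x).symm y) :=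
  ContinuousLinearMap.inverse_eq (chartSymmDeriv_comp_chartDeriv hy)
    (chartDeriv_comp_chartSymmDeriv hy)

/-- The vector field given by a frame and a constant vector, pulled back to the chart around `x`. -/
def frameField (s : ∀ p : M, TangentSpace 𝓘(ℝ, E) p ≃L[ℝ] V) (x : M) (v : V) : E → E :=
  mpullbackWithin 𝓘(ℝ, E) 𝓘(ℝ, E) (extChartAt 𝓘(ℝ, E) x).symm (fun p => (s p).symm v)
    (range 𝓘(ℝ, E))

/-- The bracket at `x` of the vector fields given by a frame and two constant vectors. -/
def frameBracket (s : ∀ p : M, TangentSpace 𝓘(ℝ, E) p ≃L[ℝ] V) (x : M) (w v : V) : E :=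
  mlieBracket 𝓘(ℝ, E) (fun p => (s p).symm w) (fun p => (s p).symm v) x

theorem frameField_apply (s : ∀ p : M, TangentSpace 𝓘(ℝ, E) p ≃L[ℝ] V) {x : M} {y : E}
    (hy : y ∈ (extChartAt 𝓘(ℝ, E) x).target) (v : V) :
    frameField s x v y = frameInChart s x y v := by
  rw [frameInChart, ← inverse_chartSymmDeriv hy, frameField, mpullbackWithin_apply]
  simp only [modelWithCornersSelf_coe, range_id, mfderivWithin_univ]
  rfl

theorem frameField_eventuallyEq (s : ∀ p : M, TangentSpace 𝓘(ℝ, E) p ≃L[ℝ] V) (x : M) (v : V) :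
    frameField s x v =ᶠ[𝓝 (extChartAt 𝓘(ℝ, E) x x)] fun y => frameInChart s x y v := by
  filter_upwards [eventually_mem_target (mem_extChartAt_target x)] with y hy
  exact frameField_apply s hy v

theorem chartDeriv_frameBracket (s : ∀ p : M, TangentSpace 𝓘(ℝ, E) p ≃L[ℝ] V) (x : M) (w v : V) :
    chartDeriv x x (frameBracket s x w v) =
      lieBracket ℝ (frameField s x w) (frameField s x v) (extChartAt 𝓘(ℝ, E) x x) := by
  have h1 : frameBracket s x w v = (chartDeriv x x).inverse (lieBracketWithin ℝ (frameField s x w)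
      (frameField s x v) ((extChartAt 𝓘(ℝ, E) x).symm ⁻¹' univ ∩ range 𝓘(ℝ, E))
      (extChartAt 𝓘(ℝ, E) x x)) := rfl
  have h2 : (extChartAt 𝓘(ℝ, E) x).symm ⁻¹' univ ∩ range 𝓘(ℝ, E) = univ := by simp
  have h3 := chartDeriv_comp_chartSymmDeriv (mem_extChartAt_target (I := 𝓘(ℝ, E)) x)
  have h4 := chartSymmDeriv_comp_chartDeriv (mem_extChartAt_target (I := 𝓘(ℝ, E)) x)
  rw [extChartAt_to_inv] at h3 h4
  rw [h1, h2, lieBracketWithin_univ, ContinuousLinearMap.inverse_eq h3 h4,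
    ← ContinuousLinearMap.comp_apply, h3, ContinuousLinearMap.id_apply]

variable [FiniteDimensional ℝ V] [CompleteSpace E]

theorem differentiableAt_frameInChart {s : ∀ p : M, TangentSpace 𝓘(ℝ, E) p ≃L[ℝ] V} {x : M}
    (hs : ∀ v, MDifferentiableAt 𝓘(ℝ, E) 𝓘(ℝ, E).tangent
      (fun p => (⟨p, (s p).symm v⟩ : TangentBundle 𝓘(ℝ, E) M)) x) :
    DifferentiableAt ℝ (frameInChart s x) (extChartAt 𝓘(ℝ, E) x x) := by
  refine differentiableAt_of_forall_apply fun v => ?_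
  have h : DifferentiableWithinAt ℝ (frameField s x v)
      ((extChartAt 𝓘(ℝ, E) x).symm ⁻¹' univ ∩ range 𝓘(ℝ, E)) (extChartAt 𝓘(ℝ, E) x x) :=
    ((hs v).mdifferentiableWithinAt (s := univ)
      ).differentiableWithinAt_mpullbackWithin_vectorField
  rw [show (extChartAt 𝓘(ℝ, E) x).symm ⁻¹' univ ∩ range 𝓘(ℝ, E) = univ by simp,
    differentiableWithinAt_univ] at h
  exact h.congr_of_eventuallyEq (frameField_eventuallyEq s x v).symm

/-- The coordinate formula for the bracket of two frame fields; with vanishing torsion it becomes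
the symmetry condition of `exists_extDeriv_comp_eq`. -/
theorem chartDeriv_frameBracket_eq_sub {s : ∀ p : M, TangentSpace 𝓘(ℝ, E) p ≃L[ℝ] V} {x : M}
    (hs : ∀ v, MDifferentiableAt 𝓘(ℝ, E) 𝓘(ℝ, E).tangent
      (fun p => (⟨p, (s p).symm v⟩ : TangentBundle 𝓘(ℝ, E) M)) x) (w v : V) :
    chartDeriv x x (frameBracket s x w v) =
      fderiv ℝ (frameInChart s x) (extChartAt 𝓘(ℝ, E) x x)
          (frameInChart s x (extChartAt 𝓘(ℝ, E) x x) w) v -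
        fderiv ℝ (frameInChart s x) (extChartAt 𝓘(ℝ, E) x x)
          (frameInChart s x (extChartAt 𝓘(ℝ, E) x x) v) w := by
  have h (v : V) (u : E) :
      fderiv ℝ (fun y => frameInChart s x y v) (extChartAt 𝓘(ℝ, E) x x) u =
        fderiv ℝ (frameInChart s x) (extChartAt 𝓘(ℝ, E) x x) u v := by
    rw [fderiv_clm_apply (differentiableAt_frameInChart hs) (differentiableAt_const v)]
    simp
  rw [chartDeriv_frameBracket, lieBracket, (frameField_eventuallyEq s x w).fderiv_eq,
    (frameField_eventuallyEq s x v).fderiv_eq, (frameField_eventuallyEq s x w).self_of_nhds,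
    (frameField_eventuallyEq s x v).self_of_nhds, h, h]

end Frame

/-! ### The exterior derivative and the bundles of forms -/

section Frame

open Filter Topology VectorField

/-- The derivative of a function with values in a closed subspace has values in that subspace. -/
theorem fderiv_mem_of_eventually_mem {E W : Type*} [NormedAddCommGroup E] [NormedSpace ℝ E]
    [NormedAddCommGroup W] [NormedSpace ℝ W] [Module ℂ W]
    [IsScalarTower ℝ ℂ W] {β : E → W} {y : E} (hβ : DifferentiableAt ℝ β y)
    {S : Submodule ℂ W} (hS : IsClosed (S : Set W)) (h : ∀ᶠ z in 𝓝 y, β z ∈ S) (u : E) :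
    fderiv ℝ β y u ∈ S := by
  have h1 : HasDerivAt (fun t : ℝ => β (y + t • u)) (fderiv ℝ β y u) 0 := by
    have hl : HasDerivAt (fun t : ℝ => y + t • u) u 0 := by
      simpa using ((hasDerivAt_id (0 : ℝ)).smul_const u).const_add y
    have hb : HasFDerivAt β (fderiv ℝ β y) (y + (0 : ℝ) • u) := by simpa using hβ.hasFDerivAt
    exact hb.comp_hasDerivAt (0 : ℝ) hl
  have hc : Tendsto (fun t : ℝ => y + t • u) (𝓝 0) (𝓝 y) := by
    have : Continuous fun t : ℝ => y + t • u := by fun_prop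
    simpa using this.tendsto 0
  refine hS.mem_of_tendsto (hasDerivAt_iff_tendsto_slope.1 h1) ?_
  refine (hc.eventually h).filter_mono nhdsWithin_le_nhds |>.mono fun t ht => ?_
  have h0 : β (y + (0 : ℝ) • u) ∈ S := by simpa using h.self_of_nhds
  rw [slope_def_module]
  exact (S.restrictScalars ℝ).smul_mem _ (S.sub_mem ht h0)

theorem exists_clm_of_linear {V : Type*} [NormedAddCommGroup V] [NormedSpace ℝ V]
    [FiniteDimensional ℝ V] (C : V → V →L[ℝ] V) (hadd : ∀ w w' v, C (w + w') v = C w v + C w' v)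
    (hsmul : ∀ (c : ℝ) w v, C (c • w) v = c • C w v) :
    ∃ A : V →L[ℝ] V →L[ℝ] V, ∀ w, A w = C w :=
  ⟨LinearMap.toContinuousLinearMap
    { toFun := C
      map_add' := fun w w' => ContinuousLinearMap.ext (hadd w w')
      map_smul' := fun c w => ContinuousLinearMap.ext (hsmul c w) }, fun _ => rfl⟩

variable {V : Type*} [NormedAddCommGroup V] [NormedSpace ℝ V]
  {E : Type*} [NormedAddCommGroup E] [NormedSpace ℝ E] [FiniteDimensional ℝ E] [CompleteSpace E]
  {M : Type*} [TopologicalSpace M] [ChartedSpace E M] [IsManifold 𝓘(ℝ, E) ∞ M]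

/-- The covariant derivative of the vector fields given by a frame, in the model space. -/
def frameCov (cov : CovariantDerivative 𝓘(ℝ, E) E (TangentSpace 𝓘(ℝ, E) : M → Type _))
    (s : ∀ p : M, TangentSpace 𝓘(ℝ, E) p ≃L[ℝ] V) (x : M) (w v : V) : E :=
  cov (fun y => (s y).symm v) x ((s x).symm w)

theorem frameCov_sub_frameCov
    {cov : CovariantDerivative 𝓘(ℝ, E) E (TangentSpace 𝓘(ℝ, E) : M → Type _)}
    (hcov : cov.torsion = 0) {s : ∀ p : M, TangentSpace 𝓘(ℝ, E) p ≃L[ℝ] V} {x : M}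
    (hs : ∀ v, MDifferentiableAt 𝓘(ℝ, E) 𝓘(ℝ, E).tangent
      (fun p => (⟨p, (s p).symm v⟩ : TangentBundle 𝓘(ℝ, E) M)) x) (w v : V) :
    frameCov cov s x w v - frameCov cov s x v w = frameBracket s x w v :=
  cov.torsion_eq_zero_iff.1 hcov (hs w) (hs v)

variable [FiniteDimensional ℝ V]

/-- `T` is the covariant derivative of `α` in the frame: the derivative of an `S`-valued function
stays in the closed subspace `S`, and the connection form preserves `S`. -/
theorem exists_d_comp_frameInv {k : ℕ} {α : DForm E M ℂ k} (hα : α.IsSmooth)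
    {cov : CovariantDerivative 𝓘(ℝ, E) E (TangentSpace 𝓘(ℝ, E) : M → Type _)}
    (hcov : cov.torsion = 0) {s : ∀ p : M, TangentSpace 𝓘(ℝ, E) p ≃L[ℝ] V} {x : M}
    (hs : ∀ v, MDifferentiableAt 𝓘(ℝ, E) 𝓘(ℝ, E).tangent
      (fun p => (⟨p, (s p).symm v⟩ : TangentBundle 𝓘(ℝ, E) M)) x)
    {A : V →L[ℝ] V →L[ℝ] V} (hA : ∀ w v, frameInv s x (A w v) = frameCov cov s x w v)
    {S : Submodule ℂ (V [⋀^Fin k]→L[ℝ] ℂ)} (hS : IsClosed (S : Set (V [⋀^Fin k]→L[ℝ] ℂ)))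
    (hAS : ∀ w, ∀ γ ∈ S, lieDer (A w) γ ∈ S)
    (hαS : ∀ᶠ p in 𝓝 x, (α.val p).compContinuousLinearMap (frameInv s p) ∈ S) :
    ∃ T : V →L[ℝ] V [⋀^Fin k]→L[ℝ] ℂ, (∀ w, T w ∈ S) ∧
      ((DForm.d α).val x).compContinuousLinearMap (frameInv s x) =
        ContinuousAlternatingMap.alternatizeUncurryFin T := by
  have hy := mem_extChartAt_target (I := 𝓘(ℝ, E)) x
  have hZ : frameInChart s x (extChartAt 𝓘(ℝ, E) x x) = chartDeriv x x ∘L frameInv s x := by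
    rw [frameInChart, extChartAt_to_inv]
  have hf := (hα.contDiffAt hy).differentiableAt (by simp)
  have hZd := differentiableAt_frameInChart hs
  obtain ⟨T, hT, hd⟩ := exists_extDeriv_comp_eq hf hZd A fun w v => by
    have h1 := chartDeriv_frameBracket_eq_sub hs w v
    have h2 : chartDeriv x x (frameBracket s x w v) =
        frameInChart s x (extChartAt 𝓘(ℝ, E) x x) (A w v) -
          frameInChart s x (extChartAt 𝓘(ℝ, E) x x) (A v w) := by
      rw [← frameCov_sub_frameCov hcov hs, map_sub, hZ, ContinuousLinearMap.comp_apply,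
        ContinuousLinearMap.comp_apply, hA, hA]
    rw [h2] at h1
    rw [sub_eq_sub_iff_add_eq_add] at h1 ⊢
    rw [← h1, add_comm]
  have hmem : ∀ᶠ y in 𝓝 (extChartAt 𝓘(ℝ, E) x x),
      (α.inChart x y).compContinuousLinearMap (frameInChart s x y) ∈ S := by
    have hc := (continuousAt_symm hy).tendsto
    rw [extChartAt_to_inv] at hc
    filter_upwards [eventually_mem_target hy, hc.eventually hαS] with y hy h
    rw [inChart_comp_frameInChart α s hy]
    exact h
  refine ⟨T, fun w => ?_, ?_⟩
  · rw [hT]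
    exact S.add_mem (fderiv_mem_of_eventually_mem
      (hf.continuousAlternatingMapCompContinuousLinearMap hZd) hS hmem _)
      (hAS _ _ hmem.self_of_nhds)
  · rw [← hd, DForm.val_d, hZ]
    rfl

end Frame

/-! ### The exterior derivative of sections of `E_{k,r}` -/

section Main

open Filter Topology

variable {n k : ℕ} {r : ℤ}

/-- The `𝔰𝔭(1)` part commutes with the Casimir operator because that operator is central; the `𝔤𝔩(n,
ℍ)` part commutes with left multiplication itself. -/
theorem lieDer_mem_isotypic {C : (Fin n → ℍ[ℝ]) →L[ℝ] (Fin n → ℍ[ℝ])}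
    (hC : (C : (Fin n → ℍ[ℝ]) → (Fin n → ℍ[ℝ])) ∈ sp1glAlgebra n) {γ : QForm n k}
    (hγ : γ ∈ isotypic (stdRep n k) r) : lieDer C γ ∈ isotypic (stdRep n k) r := by
  rcases lt_or_ge r 0 with hr | hr
  · rw [isotypic_eq_bot hr, Submodule.mem_bot] at hγ ⊢
    rw [hγ, map_zero]
  · obtain ⟨a, B, ha, hf⟩ := hC
    obtain ⟨R, hR, hRc⟩ := exists_vecMulCLM B
    have hCR : C = leftMul n a + R := by
      ext1 v
      rw [hf, _root_.add_apply, hR]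
    have h1 : lieDer C γ = quatDer a γ + lieDer R γ := by
      rw [hCR, lieDer_add]
      rfl
    rw [mem_isotypic_stdRep_iff (by omega)] at hγ ⊢
    rw [h1, map_add, casimir_quatDer ha, casimir_lieDer hRc, hγ, map_smul, map_smul, smul_add]

theorem exists_clm_of_mem_sp1glAlgebra {f : (Fin n → ℍ[ℝ]) → (Fin n → ℍ[ℝ])}
    (hf : f ∈ sp1glAlgebra n) : ∃ C : (Fin n → ℍ[ℝ]) →L[ℝ] (Fin n → ℍ[ℝ]), ⇑C = f := by
  obtain ⟨a, B, -, hf⟩ := hf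
  obtain ⟨R, hR, -⟩ := exists_vecMulCLM B
  refine ⟨leftMul n a + R, funext fun v => ?_⟩
  rw [hf, _root_.add_apply, hR]

variable {E : Type*} [NormedAddCommGroup E] [NormedSpace ℝ E]
  {M : Type*} [TopologicalSpace M] [ChartedSpace E M]

theorem mem_bundleC_sup [IsManifold 𝓘(ℝ, E) 1 M] {Q : Sp1GLStructure E M n} {x : M}
    {p : TangentSpace 𝓘(ℝ, E) x ≃L[ℝ] (Fin n → ℍ[ℝ])} (hp : p ∈ Q.frames x) {r₁ r₂ : ℤ}
    {ζ : TangentSpace 𝓘(ℝ, E) x [⋀^Fin k]→L[ℝ] ℂ}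
    (hζ : formEquiv p k ζ ∈ isotypic (stdRep n k) r₁ ⊔ isotypic (stdRep n k) r₂) :
    ζ ∈ bundleC Q k r₁ x ⊔ bundleC Q k r₂ x := by
  obtain ⟨β, hβ, γ, hγ, h⟩ := Submodule.mem_sup.1 hζ
  rw [← (formEquiv p k).symm_apply_apply ζ, ← h, map_add]
  refine Submodule.add_mem_sup ((mem_bundleC_iff Q hp _ _).2 ?_) ((mem_bundleC_iff Q hp _ _).2 ?_)
  · rwa [LinearEquiv.apply_symm_apply]
  · rwa [LinearEquiv.apply_symm_apply]

/-- No differentiation enters unless `α` vanishes identically. A nonzero value at one point `p`,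
possibly different from `x`, restricts `r`; the allowed components then exhaust the `(k+1)`-forms at
every point. -/
theorem d_mem_of_dimension_one [IsManifold 𝓘(ℝ, E) 1 M] {Q : Sp1GLStructure E M 1}
    {α : DForm E M ℂ k}
    (hαQ : ∀ x, α x ∈ bundleC Q k r x) (x : M) :
    DForm.d α x ∈ bundleC Q (k + 1) (r + 1) x ⊔ bundleC Q (k + 1) (r - 1) x := by
  by_cases h : ∃ p, α p ≠ 0
  · obtain ⟨p, hp⟩ := h
    obtain ⟨_, s, -, hpU, hsQ, -⟩ := Q.exists_section p
    obtain ⟨_, t, -, hxU, htQ, -⟩ := Q.exists_section x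
    refine mem_bundleC_sup (htQ x hxU) ?_
    exact mem_of_exists_ne_zero ((mem_bundleC_iff Q (hsQ p hpU) r (α p)).1 (hαQ p))
      ((formEquiv (s p) k).map_ne_zero_iff.2 hp) _
  · push Not at h
    have h0 : α.inChart x = fun _ => 0 := by
      funext y
      rw [DForm.inChart, h]
      rfl
    have hd : DForm.d α x = 0 := by
      have h1 (y : E) : extDeriv (fun _ : E => (0 : E [⋀^Fin k]→L[ℝ] ℂ)) y = 0 := by
        rw [extDeriv, fderiv_fun_const]
        ext v
        simp [ContinuousAlternatingMap.alternatizeUncurryFin_apply]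
      rw [DForm.d, h0, h1]
      rfl
    rw [hd]
    exact Submodule.zero_mem _

variable [FiniteDimensional ℝ E] [CompleteSpace E] [IsManifold 𝓘(ℝ, E) ∞ M]

theorem d_mem_of_admitsTorsionFreeConnection {Q : Sp1GLStructure E M n}
    (hQ : AdmitsTorsionFreeConnection Q) {α : DForm E M ℂ k} (hα : α.IsSmooth)
    (hαQ : ∀ x, α x ∈ bundleC Q k r x) (x : M) :
    DForm.d α x ∈ bundleC Q (k + 1) (r + 1) x ⊔ bundleC Q (k + 1) (r - 1) x := by
  obtain ⟨cov, -, htor, hpres⟩ := hQ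
  obtain ⟨U, s, hU, hxU, hsQ, hs⟩ := Q.exists_section x
  have hA (w : Fin n → ℍ[ℝ]) := hpres U s hU hsQ hs x hxU ((s x).symm w)
  -- The connection form in the section `s`, first chosen for each direction `w` and then assembled
  -- into a linear map of `w`.
  choose C hC using fun w => exists_clm_of_mem_sp1glAlgebra (hA w)
  have hCv (w v) : C w v = s x (cov (fun y => (s y).symm v) x ((s x).symm w)) :=
    congrFun (hC w) v
  obtain ⟨A, hAC⟩ := exists_clm_of_linear C (fun w w' v => by simp only [hCv, map_add])
    (fun c w v => by simp only [hCv, map_smul])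
  have hsd (v : Fin n → ℍ[ℝ]) : MDifferentiableAt 𝓘(ℝ, E) 𝓘(ℝ, E).tangent
      (fun p => (⟨p, (s p).symm v⟩ : TangentBundle 𝓘(ℝ, E) M)) x :=
    ((hs v).contMDiffAt (hU.mem_nhds hxU)).mdifferentiableAt (by simp)
  obtain ⟨T, hT, hd⟩ := exists_d_comp_frameInv (A := A) (S := isotypic (stdRep n k) r) hα htor hsd
    (fun w v => by
      rw [hAC, hCv]
      exact (s x).symm_apply_apply _)
    (Submodule.closed_of_finiteDimensional _)
    (fun w γ hγ => lieDer_mem_isotypic (by rw [hAC, hC]; exact hA w) hγ)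
    (by
      filter_upwards [hU.mem_nhds hxU] with p hp
      exact (mem_bundleC_iff Q (hsQ p hp) r (α p)).1 (hαQ p))
  refine mem_bundleC_sup (hsQ x hxU) ?_
  have hd' : formEquiv (s x) (k + 1) (DForm.d α x) =
      ContinuousAlternatingMap.alternatizeUncurryFin T := hd
  rw [hd']
  exact alternatizeUncurryFin_mem hT

/-- The exterior derivative of a section of `E_{k,r}`, for complex-valued forms. -/
theorem d_mem_bundleC (hn : 1 ≤ n) {Q : Sp1GLStructure E M n}
    (hQ : 2 ≤ n → AdmitsTorsionFreeConnection Q) {α : DForm E M ℂ k} (hα : α.IsSmooth)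
    (hαQ : ∀ x, α x ∈ bundleC Q k r x) (x : M) :
    DForm.d α x ∈ bundleC Q (k + 1) (r + 1) x ⊔ bundleC Q (k + 1) (r - 1) x := by
  rcases hn.eq_or_lt with rfl | hn
  · exact d_mem_of_dimension_one hαQ x
  · exact d_mem_of_admitsTorsionFreeConnection (hQ hn) hα hαQ x

end Main

/-! ### Real-valued forms -/

section Fibre

variable {V : Type*} [AddCommGroup V] [Module ℝ V] [TopologicalSpace V] {k : ℕ}

theorem complexify_apply (α : V [⋀^Fin k]→L[ℝ] ℝ) (v : Fin k → V) :
    complexify V k α v = (α v : ℂ) := rfl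

theorem complexify_injective : Function.Injective (complexify V k) := by
  intro α β h
  ext v
  have := congrArg (fun γ : V [⋀^Fin k]→L[ℝ] ℂ => γ v) h
  simpa only [complexify_apply, Complex.ofReal_inj] using this

/-- The real part of a form. -/
def reForm (β : V [⋀^Fin k]→L[ℝ] ℂ) : V [⋀^Fin k]→L[ℝ] ℝ :=
  Complex.reCLM.compContinuousAlternatingMap β

theorem reForm_apply (β : V [⋀^Fin k]→L[ℝ] ℂ) (v : Fin k → V) : reForm β v = (β v).re := rfl

theorem complexify_reForm {β : V [⋀^Fin k]→L[ℝ] ℂ} (hβ : conjForm β = β) :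
    complexify V k (reForm β) = β := by
  ext v
  rw [complexify_apply, reForm_apply, Complex.conj_eq_iff_re.1]
  rw [← conjForm_apply, hβ]

theorem conjForm_complexify (α : V [⋀^Fin k]→L[ℝ] ℝ) :
    conjForm (complexify V k α) = complexify V k α := by
  ext v
  rw [conjForm_apply, complexify_apply, Complex.conj_ofReal]

theorem conjForm_add (β γ : V [⋀^Fin k]→L[ℝ] ℂ) :
    conjForm (β + γ) = conjForm β + conjForm γ := by
  ext v
  simp [conjForm_apply]

end Fibre

section Real

variable {E : Type*} [NormedAddCommGroup E] [NormedSpace ℝ E]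

/-- The complexification of forms as a continuous linear map. -/
def ofRealFormCLM (E : Type*) [NormedAddCommGroup E] [NormedSpace ℝ E] (k : ℕ) :
    (E [⋀^Fin k]→L[ℝ] ℝ) →L[ℝ] (E [⋀^Fin k]→L[ℝ] ℂ) :=
  ContinuousLinearMap.compContinuousAlternatingMapCLM _ _ _ _ _ Complex.ofRealCLM

theorem extDeriv_ofReal {k : ℕ} {f : E → E [⋀^Fin k]→L[ℝ] ℝ} {y : E}
    (hf : DifferentiableAt ℝ f y) :
    extDeriv (fun z => Complex.ofRealCLM.compContinuousAlternatingMap (f z)) y =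
      Complex.ofRealCLM.compContinuousAlternatingMap (extDeriv f y) := by
  let L := ofRealFormCLM E k
  have h : fderiv ℝ (fun z => Complex.ofRealCLM.compContinuousAlternatingMap (f z)) y =
      L ∘L fderiv ℝ f y := (L.hasFDerivAt.comp y hf.hasFDerivAt).fderiv
  rw [extDeriv, extDeriv, h]
  ext v
  simp [ContinuousAlternatingMap.alternatizeUncurryFin_apply, L, ofRealFormCLM]

variable {M : Type*} [TopologicalSpace M] [ChartedSpace E M] {n k : ℕ} {r : ℤ}

/-- The complexification of a real-valued form on a manifold. -/
def DForm.toComplex (α : DForm E M ℝ k) : DForm E M ℂ k := fun x => complexify _ k (α x)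

theorem DForm.inChart_toComplex (α : DForm E M ℝ k) (x : M) :
    α.toComplex.inChart x =
      fun y => Complex.ofRealCLM.compContinuousAlternatingMap (α.inChart x y) := rfl

theorem DForm.IsSmooth.toComplex {α : DForm E M ℝ k} (hα : α.IsSmooth) : α.toComplex.IsSmooth := by
  intro x
  rw [DForm.inChart_toComplex]
  exact (ofRealFormCLM E k).contDiff.comp_contDiffOn (hα x)

theorem DForm.IsSmooth.d_toComplex {α : DForm E M ℝ k} (hα : α.IsSmooth) (x : M) :
    DForm.d α.toComplex x = complexify _ (k + 1) (DForm.d α x) := by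
  rw [DForm.d, DForm.inChart_toComplex, extDeriv_ofReal
    ((hα.contDiffAt (mem_extChartAt_target x)).differentiableAt (by simp))]
  rfl

variable [IsManifold 𝓘(ℝ, E) 1 M] (Q : Sp1GLStructure E M n)

theorem bundleC_disjoint (k : ℕ) (r : ℤ) (x : M) :
    Disjoint (bundleC Q k (r + 1) x) (bundleC Q k (r - 1) x) := by
  obtain ⟨_, s, -, hxU, hsQ, -⟩ := Q.exists_section x
  rw [Submodule.disjoint_def]
  intro β h1 h2
  rw [mem_bundleC_iff Q (hsQ x hxU)] at h1 h2
  exact (formEquiv (s x) k).map_eq_zero_iff.1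
    (Submodule.disjoint_def.1 (isotypic_disjoint n k r) _ h1 h2)

theorem bundleR_disjoint (k : ℕ) (r : ℤ) (x : M) :
    Disjoint (bundleR Q k (r + 1) x) (bundleR Q k (r - 1) x) := by
  rw [Submodule.disjoint_def]
  intro β h1 h2
  refine complexify_injective ?_
  rw [map_zero]
  exact Submodule.disjoint_def.1 (bundleC_disjoint Q k r x) _ h1 h2

variable {Q}

theorem conjForm_mem_bundleC {x : M} {β : TangentSpace 𝓘(ℝ, E) x [⋀^Fin k]→L[ℝ] ℂ}
    (hβ : β ∈ bundleC Q k r x) : conjForm β ∈ bundleC Q k r x := by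
  obtain ⟨_, s, -, hxU, hsQ, -⟩ := Q.exists_section x
  rw [mem_bundleC_iff Q (hsQ x hxU)] at hβ ⊢
  exact conjForm_mem_isotypic hβ

/-- Both complex components are stable under conjugation and their sum is direct, so the two parts
of a real form are each fixed by conjugation. -/
theorem mem_bundleR_sup {x : M} {ζ : TangentSpace 𝓘(ℝ, E) x [⋀^Fin k]→L[ℝ] ℝ}
    (hζ : complexify _ k ζ ∈ bundleC Q k (r + 1) x ⊔ bundleC Q k (r - 1) x) :
    ζ ∈ bundleR Q k (r + 1) x ⊔ bundleR Q k (r - 1) x := by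
  obtain ⟨β, hβ, γ, hγ, h⟩ := Submodule.mem_sup.1 hζ
  have hc : conjForm β + conjForm γ = β + γ := by
    rw [← conjForm_add, h, conjForm_complexify]
  -- This element lies in both components at once, hence is zero.
  have hsub : conjForm β - β = γ - conjForm γ := by
    rw [sub_eq_sub_iff_add_eq_add, hc, add_comm]
  have h0 : conjForm β - β = 0 :=
    Submodule.disjoint_def.1 (bundleC_disjoint Q k r x) _
      (Submodule.sub_mem _ (conjForm_mem_bundleC hβ) hβ)
      (hsub ▸ Submodule.sub_mem _ hγ (conjForm_mem_bundleC hγ))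
  have hβ' : conjForm β = β := sub_eq_zero.1 h0
  have hγ' : conjForm γ = γ := (sub_eq_zero.1 (hsub ▸ h0)).symm
  have hζ' : ζ = reForm β + reForm γ := by
    refine complexify_injective ?_
    rw [map_add, complexify_reForm hβ', complexify_reForm hγ', h]
  rw [hζ']
  refine Submodule.add_mem_sup ?_ ?_
  · change complexify _ k (reForm β) ∈ bundleC Q k (r + 1) x
    rwa [complexify_reForm hβ']
  · change complexify _ k (reForm γ) ∈ bundleC Q k (r - 1) x
    rwa [complexify_reForm hγ']

end Real
end
end QuatDolbeault

theorem theorem4p3 {E : Type*} [NormedAddCommGroup E] [NormedSpace ℝ E] [FiniteDimensional ℝ E]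
    [CompleteSpace E] {M : Type*} [TopologicalSpace M] [ChartedSpace E M]
    [IsManifold 𝓘(ℝ, E) ∞ M] (n : ℕ) (hn : 1 ≤ n) (hE : Module.finrank ℝ E = 4 * n)
    (Q : QuatDolbeault.Sp1GLStructure E M n)
    (hQ : 2 ≤ n → QuatDolbeault.AdmitsTorsionFreeConnection Q) (k : ℕ) (r : ℤ) :
    -- complex-valued forms
    (Set.MapsTo QuatDolbeault.DForm.d
        (QuatDolbeault.smoothSections (QuatDolbeault.bundleC Q k r))
        (QuatDolbeault.smoothSections fun x =>
          QuatDolbeault.bundleC Q (k + 1) (r + 1) x ⊔ QuatDolbeault.bundleC Q (k + 1) (r - 1) x) ∧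
      ∀ x : M, Disjoint (QuatDolbeault.bundleC Q (k + 1) (r + 1) x)
        (QuatDolbeault.bundleC Q (k + 1) (r - 1) x)) ∧
    -- real-valued forms
    (Set.MapsTo QuatDolbeault.DForm.d
        (QuatDolbeault.smoothSections (QuatDolbeault.bundleR Q k r))
        (QuatDolbeault.smoothSections fun x =>
          QuatDolbeault.bundleR Q (k + 1) (r + 1) x ⊔ QuatDolbeault.bundleR Q (k + 1) (r - 1) x) ∧
      ∀ x : M, Disjoint (QuatDolbeault.bundleR Q (k + 1) (r + 1) x)
        (QuatDolbeault.bundleR Q (k + 1) (r - 1) x)) := by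
  refine ⟨⟨fun α hα => ⟨hα.1.d, QuatDolbeault.d_mem_bundleC hn hQ hα.1 hα.2⟩,
    QuatDolbeault.bundleC_disjoint Q (k + 1) r⟩,
    fun α hα => ⟨hα.1.d, fun x => QuatDolbeault.mem_bundleR_sup ?_⟩,
    QuatDolbeault.bundleR_disjoint Q (k + 1) r⟩
  rw [← hα.1.d_toComplex]
  exact QuatDolbeault.d_mem_bundleC hn hQ hα.1.toComplex hα.2 x
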